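/- **Notation.** Let $\mathcal{H}_{4,4}$ be the space of real quartic forms in $(a,b,c,d)=(a_0,a_1,a_2,a_3)$, $\mathcal{P}_{4,4}\subset\mathcal{H}_{4,4}$ the cone of forms that are nonnegative on $\mathbb{R}^4$ (PSD), $\mathcal{P}_{4,4}^s$ the cone of symmetric forms in $\mathcal{P}_{4,4}$, and $\Sigma_{4,4}$ the cone of finite sums of squares of real quadratic forms. An element $f\neq 0$ of $\mathcal{P}_{4,4}$ is *extremal*, written $f\in\mathcal{E}(\mathcal{P}_{4,4})$, if $f=g+h$ with $g,h\in\mathcal{P}_{4,4}$ implies $g,h\in\mathbb{R}_{\ge 0}\cdot f$. For a form $f$ let $V_{\mathbb{R}}(f)\subset\mathbb{P}^3_{\mathbb{R}}$ be its set of real projective zeros. Put $$s_0=\sum_i a_i^4-4abcd,\quad s_1=\sum_{i\ne j}a_i^3a_j-12abcd,\quad s_2=\sum_{i<j}a_i^2a_j^2-6abcd,\quad s_3=\sum_{i}\ \sum_{j<k;\ j,k\neq i}a_i^2a_ja_k-12abcd,\quad s_4=abcd,$$ and, for $u\neq 0$, $\omega(u)=u+\frac1u-2$. Put $$\begin{aligned}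 p_0(t,w)&=(4t+2)w^2-3(t-1)^2w,\\ p_1(t,w)&=-2(t+1)^2w^2+2(t+1)(t-1)^2w,\\ p_2(t,w)&=4t^2w^2-2(t-1)^2(2t-1)w+2(t-1)^4,\\ p_3(t,w)&=2(t+1)^2w^2-(t-1)^2(t^2+3)w-2(t-1)^4,\\ p_4(t,w)&=2(t-1)^4w^2, \end{aligned}$$ $$\mathfrak{g}_{t,u}=u^2\sum_{i=0}^4p_i(t,\omega(u))\,s_i,\qquad V_F(t,w)=(3+6t-t^2)w^2-6(t-1)^2w,$$ $$D_F(t,u)=(3+6t-t^2)-(13+6t+5t^2)u+(10+9t+4t^2+t^3)u^2-(1+6t+t^2)u^3,$$ and let $\mathcal{U}\subset\mathbb{R}^2$ be the set of all $(t,u)$ with $t\notin\{0,1\}$, $u\notin\{0,1,-1\}$, $2u\neq t+1$, $tu+u\neq 2$, $D_F(t,u)\neq 0$ and $V_F(t,\omega(u))>0$. **Theorem.** (A) The set $\mathcal{U}$ is open and non-empty, and for every $(t,u)\in\mathcal{U}$: 1. $\mathfrak{g}_{t,u}\in\mathcal{P}_{4,4}^s$, $\mathfrak{g}_{t,u}(t,1,1,1)=0$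 and $\mathfrak{g}_{t,u}(u,u,1,1)=0$; 2. $\mathfrak{g}_{t,u}\in\mathcal{E}(\mathcal{P}_{4,4})$ and $\mathfrak{g}_{t,u}\notin\Sigma_{4,4}$; 3. $\mathfrak{g}_{t,u}$ is irreducible in $\mathbb{C}[a,b,c,d]$; 4. $V_{\mathbb{R}}(\mathfrak{g}_{t,u})$ consists of exactly 10 points, each of them isolated. (B) If $t\in\mathbb{R}$ and $u\in\mathbb{R}\setminus\{0,1\}$, then $\mathfrak{g}_{t,u}\in\mathcal{P}_{4,4}^s$ if and only if $V_F(t,\omega(u))\ge 0$. Moreover, $-\mathfrak{g}_{t,u}\notin\mathcal{P}_{4,4}^s$ for all $t\in\mathbb{R}$ and $u\neq 0$ with $(t,u)\neq(1,1)$. (C) If $t\neq 1$, $u\notin\{0,1,-1\}$, $V_F(t,\omega(u))>0$ and $\mathfrak{g}_{t,u}\in\mathcal{E}(\mathcal{P}_{4,4})$, then $\mathfrak{g}_{t,u}$ is irreducible in $\mathbb{C}[a,b,c,d]$ and $\mathfrak{g}_{t,u}\notin\Sigma_{4,4}$. -/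

import Mathlib

open MvPolynomial

noncomputable section

namespace SymQuartic

/-! ### Forms, PSD cones, extremal elements, sums of squares -/

/-- Forms of degree `d` in `n` real variables. -/
abbrev Forms (n d : ℕ) : Submodule ℝ (MvPolynomial (Fin n) ℝ) :=
  homogeneousSubmodule (Fin n) ℝ d

/-- Symmetric forms of degree `d` in `n` real variables. -/
def SymForms (n d : ℕ) : Submodule ℝ (MvPolynomial (Fin n) ℝ) :=
  Forms n d ⊓ Subalgebra.toSubmodule (symmetricSubalgebra (Fin n) ℝ)

/-- The PSD cone on `A` in `H`: the elements of `H` that are nonnegative at every point of `A`. -/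
def psdCone {n : ℕ} (A : Set (Fin n → ℝ)) (H : Submodule ℝ (MvPolynomial (Fin n) ℝ)) :
    Set (MvPolynomial (Fin n) ℝ) :=
  {f | f ∈ H ∧ ∀ a ∈ A, 0 ≤ eval a f}

/-- The cone of PSD forms of degree `d` in `n` variables. -/
def PSD (n d : ℕ) : Set (MvPolynomial (Fin n) ℝ) := psdCone Set.univ (Forms n d)

/-- The cone of symmetric PSD forms of degree `d` in `n` variables. -/
def SymPSD (n d : ℕ) : Set (MvPolynomial (Fin n) ℝ) := psdCone Set.univ (SymForms n d)

/-- The extremal elements of a cone `P`: the nonzero `f ∈ P` such that `f = g + h` with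
`g, h ∈ P` forces `g` and `h` to be nonnegative multiples of `f`. -/
def extremals {E : Type*} [AddCommGroup E] [Module ℝ E] (P : Set E) : Set E :=
  {f | f ∈ P ∧ f ≠ 0 ∧ ∀ g ∈ P, ∀ h ∈ P, g + h = f →
    (∃ α : ℝ, 0 ≤ α ∧ g = α • f) ∧ (∃ β : ℝ, 0 ≤ β ∧ h = β • f)}

/-- The forms of degree `2 * d` in `n` variables that are finite sums of squares of forms of
degree `d`. -/
def SOS (n d : ℕ) : Set (MvPolynomial (Fin n) ℝ) :=
  {f | ∃ (r : ℕ) (g : Fin r → MvPolynomial (Fin n) ℝ),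
    (∀ i, g i ∈ Forms n d) ∧ f = ∑ i, g i ^ 2}

/-! ### Real projective space and real zero sets -/

/-- Real projective space of dimension `n - 1`. -/
abbrev RealProj (n : ℕ) : Type := Projectivization ℝ (Fin n → ℝ)

/-- The usual topology of real projective space: the quotient topology from `ℝⁿ ∖ {0}`. -/
instance instTopologicalSpaceRealProj (n : ℕ) : TopologicalSpace (RealProj n) :=
  TopologicalSpace.coinduced
    (fun v : {v : Fin n → ℝ // v ≠ 0} => Projectivization.mk ℝ v.1 v.2) inferInstance

/-- The set of real projective zeros of a form `f`: the points all of whose homogeneous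
coordinate vectors are zeros of `f`. -/
def realZeros {n : ℕ} (f : MvPolynomial (Fin n) ℝ) : Set (RealProj n) :=
  {p | ∀ (v : Fin n → ℝ) (hv : v ≠ 0), Projectivization.mk ℝ v hv = p → eval v f = 0}

/-! ### The quartics; indices in `Fin 4` are cyclic -/

/-- `a⁴ + b⁴ + c⁴ + d⁴` -/
def S4 : MvPolynomial (Fin 4) ℝ := ∑ i, X i ^ 4

/-- `∑ aᵢ³ aⱼ` over ordered pairs `i ≠ j` -/
def T31 : MvPolynomial (Fin 4) ℝ := ∑ i, X i ^ 3 * (X (i + 1) + X (i + 2) + X (i + 3))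

/-- `∑ aᵢ² aⱼ²` over `i < j` -/
def S22 : MvPolynomial (Fin 4) ℝ := ∑ i, ∑ j ∈ Finset.Ioi i, X i ^ 2 * X j ^ 2

/-- `∑ aᵢ² aⱼ aₖ` over `i` and `j < k` different from `i` -/
def T211 : MvPolynomial (Fin 4) ℝ :=
  ∑ i, X i ^ 2 * (X (i + 1) * X (i + 2) + X (i + 1) * X (i + 3) + X (i + 2) * X (i + 3))

/-- `a b c d` -/
def U4 : MvPolynomial (Fin 4) ℝ := X 0 * X 1 * X 2 * X 3

def s0 : MvPolynomial (Fin 4) ℝ := S4 - 4 * U4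
def s1 : MvPolynomial (Fin 4) ℝ := T31 - 12 * U4
def s2 : MvPolynomial (Fin 4) ℝ := S22 - 6 * U4
def s3 : MvPolynomial (Fin 4) ℝ := T211 - 12 * U4
def s4 : MvPolynomial (Fin 4) ℝ := U4

/-- Meaningful for `u ≠ 0` only. -/
def omega (u : ℝ) : ℝ := u + 1 / u - 2

def p0 (t w : ℝ) : ℝ := (4 * t + 2) * w ^ 2 - 3 * (t - 1) ^ 2 * w
def p1 (t w : ℝ) : ℝ := -2 * (t + 1) ^ 2 * w ^ 2 + 2 * (t + 1) * (t - 1) ^ 2 * w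
def p2 (t w : ℝ) : ℝ :=
  4 * t ^ 2 * w ^ 2 - 2 * (t - 1) ^ 2 * (2 * t - 1) * w + 2 * (t - 1) ^ 4
def p3 (t w : ℝ) : ℝ :=
  2 * (t + 1) ^ 2 * w ^ 2 - (t - 1) ^ 2 * (t ^ 2 + 3) * w - 2 * (t - 1) ^ 4
def p4 (t w : ℝ) : ℝ := 2 * (t - 1) ^ 4 * w ^ 2

/-- The symmetric quaternary quartic `𝔤_{t,u}`. -/
def quartic (t u : ℝ) : MvPolynomial (Fin 4) ℝ :=
  C (u ^ 2) * (C (p0 t (omega u)) * s0 + C (p1 t (omega u)) * s1 + C (p2 t (omega u)) * s2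
    + C (p3 t (omega u)) * s3 + C (p4 t (omega u)) * s4)

def VF (t w : ℝ) : ℝ := (3 + 6 * t - t ^ 2) * w ^ 2 - 6 * (t - 1) ^ 2 * w

def DF (t u : ℝ) : ℝ :=
  (3 + 6 * t - t ^ 2) - (13 + 6 * t + 5 * t ^ 2) * u
    + (10 + 9 * t + 4 * t ^ 2 + t ^ 3) * u ^ 2 - (1 + 6 * t + t ^ 2) * u ^ 3

/-- The parameter set `𝒰 ⊆ ℝ²` of pairs `(t, u)`. -/
def paramSet : Set (ℝ × ℝ) :=
  {x | x.1 ≠ 0 ∧ x.1 ≠ 1 ∧ x.2 ≠ 0 ∧ x.2 ≠ 1 ∧ x.2 ≠ -1 ∧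
    2 * x.2 ≠ x.1 + 1 ∧ x.1 * x.2 + x.2 ≠ 2 ∧ DF x.1 x.2 ≠ 0 ∧ 0 < VF x.1 (omega x.2)}

end SymQuartic

end

/-!
On vectors with two equal coordinates `𝔤_{t,u}` is explicitly a square plus `V_F` times a square.
For fixed elementary symmetric functions `e₁, e₂, e₃` it is affine in `e₄ = abcd`, and `e₄` can be
moved in either direction, keeping four real roots, until two coordinates coincide; so
nonnegativity and the zeros of `𝔤_{t,u}` are decided on such vectors.

A nonnegative summand of `𝔤_{t,u}` has double zeros at the ten zeros. Splitting a quartic form with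
these double zeros into parts that are symmetric or antisymmetric under two disjoint transpositions
shows that it is symmetric, and then that it is a multiple of `𝔤_{t,u}`.

An extremal quartic that is a sum of squares is a square, and one that is reducible over `ℂ` splits
into real or complex conjugate factors. Since a real quadratic form in at least three variables has
either at most one or infinitely many projective zeros, both contradict the count of ten.
-/

noncomputable section

namespace SymQuartic

/-! ### The quartic as a real function -/

/-- The value of `𝔤_{t,u}` at `(a, b, c, d)` without the factor `u²`, where `w = ω(u)`. -/
def quarticFun (t w a b c d : ℝ) : ℝ :=
  p0 t w * (a ^ 4 + b ^ 4 + c ^ 4 + d ^ 4 - 4 * (a * b * c * d))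
  + p1 t w * (a ^ 3 * (b + c + d) + b ^ 3 * (c + d + a) + c ^ 3 * (d + a + b)
      + d ^ 3 * (a + b + c) - 12 * (a * b * c * d))
  + p2 t w * (a ^ 2 * b ^ 2 + a ^ 2 * c ^ 2 + a ^ 2 * d ^ 2 + b ^ 2 * c ^ 2 + b ^ 2 * d ^ 2
      + c ^ 2 * d ^ 2 - 6 * (a * b * c * d))
  + p3 t w * (a ^ 2 * (b * c + b * d + c * d) + b ^ 2 * (c * d + c * a + d * a)
      + c ^ 2 * (d * a + d * b + a * b) + d ^ 2 * (a * b + a * c + b * c) - 12 * (a * b * c * d))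
  + p4 t w * (a * b * c * d)

theorem S22_eq : S22 = X 0 ^ 2 * X 1 ^ 2 + X 0 ^ 2 * X 2 ^ 2 + X 0 ^ 2 * X 3 ^ 2
    + X 1 ^ 2 * X 2 ^ 2 + X 1 ^ 2 * X 3 ^ 2 + X 2 ^ 2 * X 3 ^ 2 := by
  have h0 : Finset.Ioi (0 : Fin 4) = {1, 2, 3} := by decide
  have h1 : Finset.Ioi (1 : Fin 4) = {2, 3} := by decide
  have h2 : Finset.Ioi (2 : Fin 4) = {3} := by decide
  have h3 : Finset.Ioi (3 : Fin 4) = ∅ := by decide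
  have h123 (F : Fin 4 → MvPolynomial (Fin 4) ℝ) : ∑ j ∈ {1, 2, 3}, F j = F 1 + F 2 + F 3 := by
    simp [add_assoc]
  have h23 (F : Fin 4 → MvPolynomial (Fin 4) ℝ) : ∑ j ∈ {2, 3}, F j = F 2 + F 3 := by simp
  simp only [S22, Fin.sum_univ_four, h0, h1, h2, h3, h123, h23, Finset.sum_singleton,
    Finset.sum_empty]
  ring

theorem T31_eq : T31 = X 0 ^ 3 * (X 1 + X 2 + X 3) + X 1 ^ 3 * (X 2 + X 3 + X 0)
    + X 2 ^ 3 * (X 3 + X 0 + X 1) + X 3 ^ 3 * (X 0 + X 1 + X 2) := by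
  simp only [T31, Fin.sum_univ_four]
  rfl

theorem T211_eq : T211 = X 0 ^ 2 * (X 1 * X 2 + X 1 * X 3 + X 2 * X 3)
    + X 1 ^ 2 * (X 2 * X 3 + X 2 * X 0 + X 3 * X 0)
    + X 2 ^ 2 * (X 3 * X 0 + X 3 * X 1 + X 0 * X 1)
    + X 3 ^ 2 * (X 0 * X 1 + X 0 * X 2 + X 1 * X 2) := by
  simp only [T211, Fin.sum_univ_four]
  rfl

theorem eval_quartic (t u : ℝ) (v : Fin 4 → ℝ) :
    eval v (quartic t u) = u ^ 2 * quarticFun t (omega u) (v 0) (v 1) (v 2) (v 3) := by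
  simp only [quartic, s0, s1, s2, s3, s4, S4, Fin.sum_univ_four, T31_eq, S22_eq, T211_eq, U4,
    map_add, map_sub, map_mul, map_pow, map_ofNat, eval_C, eval_X, quarticFun]

theorem omega_mul_self {u : ℝ} (hu : u ≠ 0) : omega u * u = (u - 1) ^ 2 := by
  simp only [omega]
  field_simp
  ring

theorem quarticFun_diag (t w x y z : ℝ) :
    quarticFun t w x x y z =
      ((2 * (t + 1) * w - (t - 1) ^ 2) * (y - z) ^ 2
        + (t - 1) ^ 2 * ((y + z) ^ 2 - 2 * (w + 2) * (y + z) * x + 4 * x ^ 2)) ^ 2 / 8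
      + VF t w * (y - z) ^ 2 * (y + z - (t + 1) * x) ^ 2 / 2 := by
  simp only [quarticFun, p0, p1, p2, p3, p4, VF]
  ring

theorem quarticFun_diag_nonneg {t w : ℝ} (hV : 0 ≤ VF t w) (x y z : ℝ) :
    0 ≤ quarticFun t w x x y z := by
  rw [quarticFun_diag]
  positivity

theorem two_mul_sub_sq_ne_zero_of_VF_pos {t w : ℝ} (hV : 0 < VF t w) :
    2 * (t + 1) * w - (t - 1) ^ 2 ≠ 0 := by
  intro h
  have : VF t w = -(w * (t + 3)) ^ 2 := by
    simp only [VF]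
    linear_combination 6 * w * h
  linarith [sq_nonneg (w * (t + 3))]

theorem cases_of_quarticFun_diag_eq_zero {t w x y z : ℝ} (ht : t ≠ 1) (hV : 0 < VF t w)
    (h : quarticFun t w x x y z = 0) :
    (y = z ∧ y ^ 2 - (w + 2) * y * x + x ^ 2 = 0) ∨ (y = x ∧ z = t * x) ∨ (y = t * x ∧ z = x) := by
  set Q := (2 * (t + 1) * w - (t - 1) ^ 2) * (y - z) ^ 2
    + (t - 1) ^ 2 * ((y + z) ^ 2 - 2 * (w + 2) * (y + z) * x + 4 * x ^ 2)
  have hsum : Q ^ 2 / 8 + VF t w * (y - z) ^ 2 * (y + z - (t + 1) * x) ^ 2 / 2 = 0 :=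
    quarticFun_diag t w x y z ▸ h
  have hR : 0 ≤ VF t w * (y - z) ^ 2 * (y + z - (t + 1) * x) ^ 2 := by positivity
  have hQ0 : Q = 0 := pow_eq_zero_iff two_ne_zero |>.1 (by linarith [sq_nonneg Q])
  have hR0 : VF t w * (y - z) ^ 2 * (y + z - (t + 1) * x) ^ 2 = 0 := by linarith [sq_nonneg Q]
  have hyz : y = z ∨ z = (t + 1) * x - y := by
    have : (y - z) * (y + z - (t + 1) * x) = 0 := by
      simpa [hV.ne', mul_assoc] using hR0
    exact (mul_eq_zero.1 this).imp sub_eq_zero.1 fun h => by linarith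
  rcases hyz with rfl | rfl
  · have : (t - 1) ^ 2 * (y ^ 2 - (w + 2) * y * x + x ^ 2) = 0 := by linear_combination hQ0 / 4
    exact .inl ⟨rfl, (mul_eq_zero.1 this).resolve_left (pow_ne_zero 2 (sub_ne_zero.2 ht))⟩
  · have : (2 * (t + 1) * w - (t - 1) ^ 2) * ((y - x) * (y - t * x)) = 0 := by
      linear_combination hQ0 / 4
    rcases mul_eq_zero.1 ((mul_eq_zero.1 this).resolve_left
      (two_mul_sub_sq_ne_zero_of_VF_pos hV)) with h | h
    · exact .inr (.inl ⟨by linarith, by linarith⟩)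
    · exact .inr (.inr ⟨by linarith, by linarith⟩)

/-! ### Moving the product of the coordinates -/

/-- The monic quartic with roots `a, b, c, d`, whose coefficients are the elementary symmetric
functions of the roots up to sign: two of these quartics differ by a constant if and only if
their roots have the same `e₁, e₂, e₃`. -/
def rootQuartic (a b c d r : ℝ) : ℝ := (r - a) * (r - b) * (r - c) * (r - d)

/-- The coefficient of `e₄` in `quarticFun t w`, written as a polynomial in the elementary
symmetric functions `e₁, e₂, e₃, e₄` of the coordinates. -/
def e4Coeff (t w : ℝ) : ℝ := -8 * p0 t w - 8 * p1 t w - 4 * p2 t w - 16 * p3 t w + p4 t w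

theorem quarticFun_eq_add_of_rootQuartic_eq_add {a b c d a' b' c' d' m : ℝ} (t w : ℝ)
    (h : ∀ r, rootQuartic a b c d r = rootQuartic a' b' c' d' r + m) :
    quarticFun t w a b c d = quarticFun t w a' b' c' d' + e4Coeff t w * m := by
  have elementary (a b c d : ℝ) : ∃ e₁ e₂ e₃ e₄ : ℝ,
      (∀ r, rootQuartic a b c d r = r ^ 4 - e₁ * r ^ 3 + e₂ * r ^ 2 - e₃ * r + e₄) ∧
      quarticFun t w a b c d = p0 t w * (e₁ ^ 4 - 4 * e₁ ^ 2 * e₂ + 2 * e₂ ^ 2 + 4 * e₁ * e₃)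
        + p1 t w * (e₁ ^ 2 * e₂ - 2 * e₂ ^ 2 - e₁ * e₃) + p2 t w * (e₂ ^ 2 - 2 * e₁ * e₃)
        + p3 t w * (e₁ * e₃) + e4Coeff t w * e₄ := by
    refine ⟨a + b + c + d, a * b + a * c + a * d + b * c + b * d + c * d,
      a * b * c + a * b * d + a * c * d + b * c * d, a * b * c * d, fun r => ?_, ?_⟩
    · simp only [rootQuartic]
      ring
    · simp only [quarticFun, e4Coeff]
      ring
  obtain ⟨e₁, e₂, e₃, e₄, hroot, hfun⟩ := elementary a b c d
  obtain ⟨e₁', e₂', e₃', e₄', hroot', hfun'⟩ := elementary a' b' c' d'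
  simp only [hroot, hroot'] at h
  have h₀ := h 0
  have h₁ := h 1
  have h₂ := h (-1)
  have h₃ := h 2
  obtain rfl : e₁ = e₁' := by linarith
  obtain rfl : e₂ = e₂' := by linarith
  obtain rfl : e₃ = e₃' := by linarith
  obtain rfl : e₄ = e₄' + m := by linarith
  rw [hfun, hfun']
  ring

theorem exists_quadratic_eq_mul_of_nonpos {β γ s : ℝ} (h : s ^ 2 + β * s + γ ≤ 0) :
    ∃ y z : ℝ, y ≤ z ∧ ∀ r, r ^ 2 + β * r + γ = (r - y) * (r - z) := by
  have hD : 0 ≤ β ^ 2 - 4 * γ := by nlinarith [sq_nonneg (2 * s + β)]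
  refine ⟨(-β - √(β ^ 2 - 4 * γ)) / 2, (-β + √(β ^ 2 - 4 * γ)) / 2, ?_, fun r => ?_⟩
  · linarith [Real.sqrt_nonneg (β ^ 2 - 4 * γ)]
  · linear_combination Real.sq_sqrt hD / 4

theorem hasDerivAt_rootQuartic (a b c d x : ℝ) : HasDerivAt (rootQuartic a b c d)
    (4 * x ^ 3 - 3 * (a + b + c + d) * x ^ 2
      + 2 * (a * b + a * c + a * d + b * c + b * d + c * d) * x
      - (a * b * c + a * b * d + a * c * d + b * c * d)) x := by
  have h := ((((hasDerivAt_id x).sub_const a).mul ((hasDerivAt_id x).sub_const b)).mul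
    ((hasDerivAt_id x).sub_const c)).mul ((hasDerivAt_id x).sub_const d)
  refine HasDerivAt.congr_deriv (f := rootQuartic a b c d) h ?_
  simp only [id_eq, Pi.mul_apply]
  ring

theorem exists_rootQuartic_eq_add_of_deriv_eq_zero {a b c d x s : ℝ}
    (hd : deriv (rootQuartic a b c d) x = 0) (hs : s ≠ x)
    (h : rootQuartic a b c d s ≤ rootQuartic a b c d x) :
    ∃ y z : ℝ, y ≤ z ∧
      ∀ r, rootQuartic a b c d r = rootQuartic x x y z r + rootQuartic a b c d x := by
  rw [(hasDerivAt_rootQuartic a b c d x).deriv] at hd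
  set β := 2 * x - (a + b + c + d)
  set γ := (a * b + a * c + a * d + b * c + b * d + c * d) + 3 * x ^ 2 - 2 * x * (a + b + c + d)
  have taylor (r : ℝ) : rootQuartic a b c d r
      = (r - x) ^ 2 * (r ^ 2 + β * r + γ) + rootQuartic a b c d x := by
    simp only [rootQuartic]
    linear_combination (r - x) * hd
  have hq : s ^ 2 + β * s + γ ≤ 0 := by
    have hmul : (s - x) ^ 2 * (s ^ 2 + β * s + γ) ≤ 0 := by linarith [taylor s]
    exact nonpos_of_mul_nonpos_right hmul (sq_pos_of_ne_zero (sub_ne_zero.2 hs))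
  obtain ⟨y, z, hyz, hfac⟩ := exists_quadratic_eq_mul_of_nonpos hq
  refine ⟨y, z, hyz, fun r => ?_⟩
  rw [taylor, hfac, rootQuartic.eq_def x x y z r]
  ring

theorem exists_deriv_rootQuartic_eq_zero (a b c d : ℝ) {p q : ℝ} (hpq : p < q)
    (hp : rootQuartic a b c d p = 0) (hq : rootQuartic a b c d q = 0) :
    ∃ x ∈ Set.Ioo p q, deriv (rootQuartic a b c d) x = 0 :=
  exists_deriv_eq_zero hpq
    (fun x _ => (hasDerivAt_rootQuartic a b c d x).continuousAt.continuousWithinAt)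
    (hp.trans hq.symm)

theorem exists_rootQuartic_eq_add_pos {a b c d : ℝ} (hab : a < b) (hbc : b < c) (hcd : c < d) :
    ∃ x y z m : ℝ, y < x ∧ x < z ∧ 0 < m ∧
      ∀ r, rootQuartic a b c d r = rootQuartic x x y z r + m := by
  obtain ⟨x, ⟨hbx, hxc⟩, hd⟩ := exists_deriv_rootQuartic_eq_zero a b c d hbc
    (by simp [rootQuartic]) (by simp [rootQuartic])
  have hm : 0 < rootQuartic a b c d x :=
    mul_pos_of_neg_of_neg (mul_neg_of_pos_of_neg (mul_pos (by linarith) (by linarith))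
      (by linarith)) (by linarith)
  obtain ⟨y, z, hyz, hr⟩ := exists_rootQuartic_eq_add_of_deriv_eq_zero (s := b) hd hbx.ne
    (le_of_eq_of_le (by simp [rootQuartic]) hm.le)
  have between {s : ℝ} (hs : rootQuartic a b c d s = 0) : y < s ∧ s < z := by
    have hneg : (s - x) * (s - x) * (s - y) * (s - z) < 0 := by
      have : (s - x) * (s - x) * (s - y) * (s - z) + rootQuartic a b c d x = 0 :=
        (hr s).symm.trans hs
      linarith
    have hneg' : (s - y) * (s - z) < 0 := by
      by_contra! h
      nlinarith [mul_nonneg (mul_self_nonneg (s - x)) h]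
    rcases mul_neg_iff.1 hneg' with h | h <;> constructor <;> linarith
  exact ⟨x, y, z, _, (between (by simp [rootQuartic])).1.trans hbx,
    hxc.trans (between (by simp [rootQuartic])).2, hm, hr⟩

theorem exists_rootQuartic_eq_add_neg {a b c d : ℝ} (hab : a < b) (hbc : b < c) (hcd : c < d) :
    ∃ x y z m : ℝ, m < 0 ∧ ∀ r, rootQuartic a b c d r = rootQuartic x x y z r + m := by
  obtain ⟨x₁, ⟨hax, hxb⟩, hd₁⟩ := exists_deriv_rootQuartic_eq_zero a b c d hab
    (by simp [rootQuartic]) (by simp [rootQuartic])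
  obtain ⟨x₂, ⟨hcx, hxd⟩, hd₂⟩ := exists_deriv_rootQuartic_eq_zero a b c d hcd
    (by simp [rootQuartic]) (by simp [rootQuartic])
  have hlt : x₁ < x₂ := by linarith
  have hm₁ : rootQuartic a b c d x₁ < 0 :=
    mul_neg_of_pos_of_neg (mul_pos_of_neg_of_neg (mul_neg_of_pos_of_neg (by linarith)
      (by linarith)) (by linarith)) (by linarith)
  have hm₂ : rootQuartic a b c d x₂ < 0 :=
    mul_neg_of_pos_of_neg (mul_pos (mul_pos (by linarith) (by linarith)) (by linarith))
      (by linarith)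
  rcases le_total (rootQuartic a b c d x₁) (rootQuartic a b c d x₂) with h | h
  · obtain ⟨y, z, -, hr⟩ := exists_rootQuartic_eq_add_of_deriv_eq_zero hd₂ hlt.ne h
    exact ⟨x₂, y, z, _, hm₂, hr⟩
  · obtain ⟨y, z, -, hr⟩ := exists_rootQuartic_eq_add_of_deriv_eq_zero hd₁ hlt.ne' h
    exact ⟨x₁, y, z, _, hm₁, hr⟩

theorem quarticFun_nonneg_of_lt {t w a b c d : ℝ} (hV : 0 ≤ VF t w) (hab : a < b) (hbc : b < c)
    (hcd : c < d) : 0 ≤ quarticFun t w a b c d := by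
  rcases le_total 0 (e4Coeff t w) with hε | hε
  · obtain ⟨x, y, z, m, -, -, hm, hr⟩ := exists_rootQuartic_eq_add_pos hab hbc hcd
    rw [quarticFun_eq_add_of_rootQuartic_eq_add t w hr]
    exact add_nonneg (quarticFun_diag_nonneg hV x y z) (mul_nonneg hε hm.le)
  · obtain ⟨x, y, z, m, hm, hr⟩ := exists_rootQuartic_eq_add_neg hab hbc hcd
    rw [quarticFun_eq_add_of_rootQuartic_eq_add t w hr]
    exact add_nonneg (quarticFun_diag_nonneg hV x y z) (mul_nonneg_of_nonpos_of_nonpos hε hm.le)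

theorem quarticFun_pos_of_lt {t w a b c d : ℝ} (ht : t ≠ 1) (hV : 0 < VF t w) (hab : a < b)
    (hbc : b < c) (hcd : c < d) : 0 < quarticFun t w a b c d := by
  rcases le_or_gt 0 (e4Coeff t w) with hε | hε
  · obtain ⟨x, y, z, m, hyx, hxz, hm, hr⟩ := exists_rootQuartic_eq_add_pos hab hbc hcd
    have hne : quarticFun t w x x y z ≠ 0 := fun h0 => by
      rcases cases_of_quarticFun_diag_eq_zero ht hV h0 with ⟨h, -⟩ | ⟨h, -⟩ | ⟨-, h⟩ <;> linarith
    rw [quarticFun_eq_add_of_rootQuartic_eq_add t w hr]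
    exact add_pos_of_pos_of_nonneg ((quarticFun_diag_nonneg hV.le x y z).lt_of_ne' hne)
      (mul_nonneg hε hm.le)
  · obtain ⟨x, y, z, m, hm, hr⟩ := exists_rootQuartic_eq_add_neg hab hbc hcd
    rw [quarticFun_eq_add_of_rootQuartic_eq_add t w hr]
    exact add_pos_of_nonneg_of_pos (quarticFun_diag_nonneg hV.le x y z)
      (mul_pos_of_neg_of_neg hε hm)

/-! ### Symmetry and homogeneity -/

theorem isHomogeneous_psum (σ R : Type*) [Fintype σ] [CommSemiring R] (n : ℕ) :
    (psum σ R n).IsHomogeneous n :=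
  IsHomogeneous.sum _ _ _ fun i _ => by simpa using (isHomogeneous_X R i).pow n

theorem isHomogeneous_U4 : U4.IsHomogeneous 4 :=
  (((isHomogeneous_X ℝ 0).mul (isHomogeneous_X ℝ 1)).mul (isHomogeneous_X ℝ 2)).mul
    (isHomogeneous_X ℝ 3)

theorem isSymmetric_U4 : U4.IsSymmetric := by
  have hprod : U4 = ∏ i : Fin 4, X i := by simp [U4, Fin.prod_univ_four]
  intro σ
  simpa only [hprod, map_prod, rename_X] using
    Equiv.prod_comp σ fun i => (X i : MvPolynomial (Fin 4) ℝ)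

theorem exists_quartic_eq_psum (t u : ℝ) : ∃ α β γ δ ε : ℝ,
    quartic t u = C α * psum (Fin 4) ℝ 4 + C β * (psum (Fin 4) ℝ 3 * psum (Fin 4) ℝ 1)
      + C γ * (psum (Fin 4) ℝ 2 * psum (Fin 4) ℝ 2)
      + C δ * (psum (Fin 4) ℝ 2 * psum (Fin 4) ℝ 1 * psum (Fin 4) ℝ 1) + C ε * U4 := by
  set w := omega u with hw
  refine ⟨u ^ 2 * (p0 t w - p1 t w - p2 t w / 2 + p3 t w), u ^ 2 * (p1 t w - p3 t w),
    u ^ 2 * (p2 t w - p3 t w) / 2, u ^ 2 * p3 t w / 2,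
    u ^ 2 * (p4 t w - 4 * p0 t w - 12 * p1 t w - 6 * p2 t w - 12 * p3 t w),
    MvPolynomial.funext fun v => ?_⟩
  simp only [eval_quartic, quarticFun, ← hw, psum, U4, Fin.sum_univ_four, map_add, map_mul,
    map_pow, eval_X, eval_C]
  ring

theorem quartic_mem_SymForms (t u : ℝ) : quartic t u ∈ SymForms 4 4 := by
  obtain ⟨α, β, γ, δ, ε, h⟩ := exists_quartic_eq_psum t u
  rw [h]
  have hom := isHomogeneous_psum (Fin 4) ℝ
  have sym (n : ℕ) : psum (Fin 4) ℝ n ∈ symmetricSubalgebra (Fin 4) ℝ := psum_isSymmetric _ _ n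
  refine ⟨((((hom 4).C_mul α).add (((hom 3).mul (hom 1)).C_mul β)).add
    (((hom 2).mul (hom 2)).C_mul γ)).add ((((hom 2).mul (hom 1)).mul (hom 1)).C_mul δ) |>.add
    (isHomogeneous_U4.C_mul ε), ?_⟩
  simp only [← smul_eq_C_mul]
  exact add_mem (add_mem (add_mem (add_mem (Subalgebra.smul_mem _ (sym 4) α)
    (Subalgebra.smul_mem _ (mul_mem (sym 3) (sym 1)) β))
    (Subalgebra.smul_mem _ (mul_mem (sym 2) (sym 2)) γ))
    (Subalgebra.smul_mem _ (mul_mem (mul_mem (sym 2) (sym 1)) (sym 1)) δ))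
    (Subalgebra.smul_mem _ isSymmetric_U4 ε)

theorem isHomogeneous_quartic (t u : ℝ) : (quartic t u).IsHomogeneous 4 :=
  (quartic_mem_SymForms t u).1

theorem isSymmetric_quartic (t u : ℝ) : (quartic t u).IsSymmetric :=
  (quartic_mem_SymForms t u).2

theorem eval_comp_perm {σ R : Type*} [CommSemiring R] {f : MvPolynomial σ R} (hf : f.IsSymmetric)
    (v : σ → R) (e : Equiv.Perm σ) : eval (v ∘ e) f = eval v f := by
  rw [← eval_rename, hf e]

/-! ### Nonnegativity -/

theorem exists_perm_of_ne {i j : Fin 4} (h : i ≠ j) :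
    ∃ σ : Equiv.Perm (Fin 4), σ 0 = i ∧ σ 1 = j := by
  revert i j
  decide

theorem exists_perm_eq_or_lt {α : Type*} [LinearOrder α] (v : Fin 4 → α) :
    ∃ σ : Equiv.Perm (Fin 4),
      v (σ 0) = v (σ 1) ∨ (v (σ 0) < v (σ 1) ∧ v (σ 1) < v (σ 2) ∧ v (σ 2) < v (σ 3)) := by
  by_cases hv : Function.Injective v
  · have hm : StrictMono (v ∘ Tuple.sort v) :=
      (Tuple.monotone_sort v).strictMono_of_injective (hv.comp (Tuple.sort v).injective)
    exact ⟨Tuple.sort v, .inr ⟨hm (by decide), hm (by decide), hm (by decide)⟩⟩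
  · obtain ⟨i, j, hij, hne⟩ := Function.not_injective_iff.1 hv
    obtain ⟨σ, rfl, rfl⟩ := exists_perm_of_ne hne
    exact ⟨σ, .inl hij⟩

theorem eval_quartic_perm (t u : ℝ) (v : Fin 4 → ℝ) (σ : Equiv.Perm (Fin 4)) :
    eval v (quartic t u)
      = u ^ 2 * quarticFun t (omega u) (v (σ 0)) (v (σ 1)) (v (σ 2)) (v (σ 3)) := by
  rw [← eval_comp_perm (isSymmetric_quartic t u) v σ, eval_quartic]
  rfl

theorem eval_quartic_nonneg {t u : ℝ} (hV : 0 ≤ VF t (omega u)) (v : Fin 4 → ℝ) :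
    0 ≤ eval v (quartic t u) := by
  obtain ⟨σ, hσ⟩ := exists_perm_eq_or_lt v
  rw [eval_quartic_perm t u v σ]
  refine mul_nonneg (sq_nonneg u) ?_
  rcases hσ with heq | ⟨h₀₁, h₁₂, h₂₃⟩
  · rw [heq]
    exact quarticFun_diag_nonneg hV _ _ _
  · exact quarticFun_nonneg_of_lt hV h₀₁ h₁₂ h₂₃

theorem exists_quarticFun_neg {t w y : ℝ} (hV : VF t w < 0) (hy : y ^ 2 - (w + 2) * y + 1 = 0)
    (hyt : 2 * y ≠ t + 1) : ∃ e, quarticFun t w 1 1 (y + e) (y - e) < 0 := by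
  set M := 2 * (t + 1) * w - (t - 1) ^ 2
  have hk : 0 < (2 * y - (t + 1)) ^ 2 := sq_pos_of_ne_zero (sub_ne_zero.2 hyt)
  -- `(1, 1, y, y)` is a zero, and near it the value is `2e²(M²e² + V_F k²)` with `k = 2y - (t + 1)`
  have hval (e : ℝ) : quarticFun t w 1 1 (y + e) (y - e)
      = 2 * e ^ 2 * (M ^ 2 * e ^ 2 + VF t w * (2 * y - (t + 1)) ^ 2) := by
    rw [quarticFun_diag]
    linear_combination (4 * M * (t - 1) ^ 2 * e ^ 2
      + 2 * (t - 1) ^ 4 * (y ^ 2 - (w + 2) * y + 1)) * hy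
  set r := -VF t w * (2 * y - (t + 1)) ^ 2 / (M ^ 2 + 1)
  have hr0 : 0 < r := div_pos (mul_pos (neg_pos.2 hV) hk) (by positivity)
  have hrM : r * (M ^ 2 + 1) = -VF t w * (2 * y - (t + 1)) ^ 2 :=
    div_mul_cancel₀ _ (by positivity)
  refine ⟨√r, ?_⟩
  rw [hval, Real.sq_sqrt hr0.le]
  nlinarith

theorem quartic_mem_SymPSD_iff {t u : ℝ} (hu : u ≠ 0) :
    quartic t u ∈ SymPSD 4 4 ↔ 0 ≤ VF t (omega u) := by
  refine ⟨fun h => ?_, fun h => ⟨quartic_mem_SymForms t u, fun v _ => eval_quartic_nonneg h v⟩⟩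
  by_contra! hV
  have hw := omega_mul_self hu
  -- the two roots of `y² - (ω(u) + 2) y + 1` are `u` and `1 / u`
  obtain ⟨y, hy, hyt⟩ : ∃ y, y ^ 2 - (omega u + 2) * y + 1 = 0 ∧ 2 * y ≠ t + 1 := by
    by_cases htu : 2 * u = t + 1
    · refine ⟨1 / u, by field_simp; linear_combination -hw, fun htu' => ?_⟩
      have hinv : 1 / u = u := by linarith
      have husq : u * u = 1 := by
        field_simp at hinv
        linarith
      rcases mul_self_eq_one_iff.1 husq with rfl | rfl
      · norm_num [VF, omega] at hV
      · obtain rfl : t = -3 := by linarith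
        norm_num [VF, omega] at hV
    · exact ⟨u, by linear_combination -hw, htu⟩
  obtain ⟨e, he⟩ := exists_quarticFun_neg hV hy hyt
  have hnonneg := h.2 ![1, 1, y + e, y - e] trivial
  rw [eval_quartic] at hnonneg
  exact he.not_ge (nonneg_of_mul_nonneg_right hnonneg (by positivity))

theorem exists_quarticFun_pos {t u : ℝ} (hu : u ≠ 0) (htu : (t, u) ≠ (1, 1)) :
    ∃ a b c d, 0 < quarticFun t (omega u) a b c d := by
  rcases eq_or_ne u 1 with rfl | hu1
  · have ht : t - 1 ≠ 0 := sub_ne_zero.2 fun h => htu (by rw [h])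
    have hval : quarticFun t (omega 1) 1 1 0 0 = 2 * (t - 1) ^ 4 := by
      simp only [quarticFun, p0, p1, p2, p3, p4, omega]
      ring
    exact ⟨1, 1, 0, 0, hval ▸ by positivity⟩
  have hw : omega u ≠ 0 :=
    left_ne_zero_of_mul (omega_mul_self hu ▸ pow_ne_zero 2 (sub_ne_zero.2 hu1))
  rcases eq_or_ne t 1 with rfl | ht
  · have hval : quarticFun 1 (omega u) 1 0 0 0 = 6 * omega u ^ 2 := by
      simp only [quarticFun, p0, p1, p2, p3, p4]
      ring
    exact ⟨1, 0, 0, 0, hval ▸ by positivity⟩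
  · have : t - 1 ≠ 0 := sub_ne_zero.2 ht
    have hval : quarticFun t (omega u) 1 1 1 1 = 2 * (t - 1) ^ 4 * omega u ^ 2 := by
      simp only [quarticFun, p0, p1, p2, p3, p4]
      ring
    exact ⟨1, 1, 1, 1, hval ▸ by positivity⟩

theorem neg_quartic_notMem_SymPSD {t u : ℝ} (hu : u ≠ 0) (htu : (t, u) ≠ (1, 1)) :
    -quartic t u ∉ SymPSD 4 4 := by
  obtain ⟨a, b, c, d, hpos⟩ := exists_quarticFun_pos hu htu
  intro h
  have hneg : 0 ≤ -(u ^ 2 * quarticFun t (omega u) a b c d) := by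
    simpa [eval_quartic] using h.2 ![a, b, c, d] trivial
  linarith [mul_pos (by positivity : 0 < u ^ 2) hpos]

/-! ### The parameter set -/

theorem isOpen_paramSet : IsOpen paramSet := by
  have hcont (x : ℝ × ℝ) (hx : x.2 ≠ 0) : ContinuousAt (fun x => VF x.1 (omega x.2)) x := by
    unfold VF omega
    fun_prop (disch := exact hx)
  have hDF : Continuous fun x : ℝ × ℝ => DF x.1 x.2 := by
    unfold DF
    fun_prop
  refine isOpen_iff_mem_nhds.2 fun x ⟨ht₀, ht₁, hu₀, hu₁, hu₂, h₁, h₂, hD, hV⟩ => ?_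
  filter_upwards [(isOpen_ne_fun continuous_fst continuous_const).mem_nhds ht₀,
    (isOpen_ne_fun continuous_fst continuous_const).mem_nhds ht₁,
    (isOpen_ne_fun continuous_snd continuous_const).mem_nhds hu₀,
    (isOpen_ne_fun continuous_snd continuous_const).mem_nhds hu₁,
    (isOpen_ne_fun continuous_snd continuous_const).mem_nhds hu₂,
    (isOpen_ne_fun (f := fun y : ℝ × ℝ => 2 * y.2) (g := fun y => y.1 + 1)
      (by fun_prop) (by fun_prop)).mem_nhds h₁,
    (isOpen_ne_fun (f := fun y : ℝ × ℝ => y.1 * y.2 + y.2) (g := fun _ => 2)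
      (by fun_prop) (by fun_prop)).mem_nhds h₂,
    (isOpen_ne_fun hDF continuous_const).mem_nhds hD,
    (hcont x hu₀).eventually_const_lt hV] with y ht₀ ht₁ hu₀ hu₁ hu₂ h₁ h₂ hD hV
  exact ⟨ht₀, ht₁, hu₀, hu₁, hu₂, h₁, h₂, hD, hV⟩

theorem paramSet_nonempty : paramSet.Nonempty :=
  ⟨(2, -2), by norm_num [paramSet, DF, VF, omega]⟩

/-! ### Real projective zeros -/

theorem eval_smul_of_isHomogeneous {σ R : Type*} [CommSemiring R] {k : ℕ} {f : MvPolynomial σ R}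
    (hf : f.IsHomogeneous k) (r : R) (v : σ → R) : eval (r • v) f = r ^ k * eval v f := by
  rw [eval_eq, eval_eq, Finset.mul_sum]
  refine Finset.sum_congr rfl fun d hd => ?_
  simp only [Pi.smul_apply, smul_eq_mul, mul_pow, Finset.prod_mul_distrib,
    Finset.prod_pow_eq_pow_sum, ← hf.degree_eq_sum_deg_support hd]
  exact mul_left_comm _ _ _

theorem mk_mem_realZeros_iff {n k : ℕ} {f : MvPolynomial (Fin n) ℝ} (hf : f.IsHomogeneous k)
    {v : Fin n → ℝ} (hv : v ≠ 0) :
    Projectivization.mk ℝ v hv ∈ realZeros f ↔ eval v f = 0 := by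
  refine ⟨fun h => h v hv rfl, fun h v' hv' he => ?_⟩
  obtain ⟨r, rfl⟩ := (Projectivization.mk_eq_mk_iff' ℝ _ _ hv' hv).1 he
  rw [eval_smul_of_isHomogeneous hf, h, mul_zero]

theorem mk_eq_mk_iff_forall_mul_eq {n : ℕ} {v w : Fin n → ℝ} (hv : v ≠ 0) (hw : w ≠ 0) :
    Projectivization.mk ℝ v hv = Projectivization.mk ℝ w hw ↔ ∀ i j, v i * w j = v j * w i := by
  rw [Projectivization.mk_eq_mk_iff']
  constructor
  · rintro ⟨r, rfl⟩ i j
    simp only [Pi.smul_apply, smul_eq_mul]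
    ring
  · intro h
    obtain ⟨j, hj⟩ := Function.ne_iff.1 hw
    refine ⟨v j / w j, funext fun i => ?_⟩
    rw [Pi.smul_apply, smul_eq_mul, div_mul_eq_mul_div, div_eq_iff hj, h i j]

instance instT1SpaceRealProj (n : ℕ) : T1Space (RealProj n) := by
  refine ⟨fun p => ?_⟩
  induction p using Projectivization.ind with | h w hw =>
  refine isClosed_coinduced.2 ?_
  have hpre : (fun v : {v : Fin n → ℝ // v ≠ 0} => Projectivization.mk ℝ v.1 v.2) ⁻¹'
      {Projectivization.mk ℝ w hw} = ⋂ i, ⋂ j, {v | v.1 i * w j = v.1 j * w i} := by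
    ext v
    simp only [Set.mem_preimage, Set.mem_singleton_iff, Set.mem_iInter, Set.mem_ofPred_eq,
      mk_eq_mk_iff_forall_mul_eq]
  rw [hpre]
  exact isClosed_iInter fun i => isClosed_iInter fun j =>
    isClosed_eq (((continuous_apply i).comp continuous_subtype_val).mul continuous_const)
      (((continuous_apply j).comp continuous_subtype_val).mul continuous_const)

/-- The index set of the zeros of `𝔤_{t,u}`: singletons for the orbit of `(t, 1, 1, 1)`, pairs
for the orbit of `(u, u, 1, 1)`. -/
def zeroIndex : Finset (Finset (Fin 4)) := {S | S.card = 1 ∨ S.card = 2}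

/-- The zero of `𝔤_{t,u}` with index `S`: its coordinates in `S` are `t` if `S` is a singleton and
`u` otherwise, and the other coordinates are `1`. -/
def zeroVec (t u : ℝ) (S : Finset (Fin 4)) : Fin 4 → ℝ :=
  fun i => if i ∈ S then (if S.card = 1 then t else u) else 1

theorem mem_zeroIndex {S : Finset (Fin 4)} : S ∈ zeroIndex ↔ S.card = 1 ∨ S.card = 2 := by
  simp [zeroIndex]

theorem zeroVec_ne_zero (t : ℝ) {u : ℝ} (hu : u ≠ 0) (S : Finset (Fin 4)) :
    zeroVec t u S ≠ 0 := by
  intro h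
  have hmem (i : Fin 4) : i ∈ S := by
    by_contra hi
    simpa [zeroVec, hi] using congrFun h i
  obtain rfl : S = Finset.univ := Finset.eq_univ_iff_forall.2 hmem
  exact hu (by simpa [zeroVec] using congrFun h 0)

theorem zeroVec_map_comp (t u : ℝ) (S : Finset (Fin 4)) (σ : Equiv.Perm (Fin 4)) :
    zeroVec t u (S.map σ.toEmbedding) ∘ σ = zeroVec t u S := by
  ext i
  simp [zeroVec]

theorem eval_quartic_triple (t u : ℝ) : eval ![t, 1, 1, 1] (quartic t u) = 0 := by
  have h : quarticFun t (omega u) t 1 1 1 = 0 := by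
    simp only [quarticFun, p0, p1, p2, p3, p4]
    ring
  simp [eval_quartic, h]

theorem eval_quartic_pair (t : ℝ) {u : ℝ} (hu : u ≠ 0) :
    eval ![u, u, 1, 1] (quartic t u) = 0 := by
  have h : quarticFun t (omega u) u u 1 1 = 0 := by
    rw [quarticFun_diag]
    linear_combination 2 * (t - 1) ^ 4 * (1 - (omega u + 2) * u + u ^ 2) * (-omega_mul_self hu)
  simp [eval_quartic, h]

theorem eval_zeroVec (t : ℝ) {u : ℝ} (hu : u ≠ 0) {S : Finset (Fin 4)} (hS : S ∈ zeroIndex) :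
    eval (zeroVec t u S) (quartic t u) = 0 := by
  have hmap (σ : Equiv.Perm (Fin 4)) (T : Finset (Fin 4))
      (hT : eval (zeroVec t u T) (quartic t u) = 0) :
      eval (zeroVec t u (T.map σ.toEmbedding)) (quartic t u) = 0 := by
    rwa [← eval_comp_perm (isSymmetric_quartic t u) _ σ, zeroVec_map_comp]
  rcases mem_zeroIndex.1 hS with hcard | hcard
  · obtain ⟨i, rfl⟩ := Finset.card_eq_one.1 hcard
    have hvec : zeroVec t u {0} = ![t, 1, 1, 1] := by
      ext i
      fin_cases i <;> simp [zeroVec]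
    simpa using hmap (Equiv.swap 0 i) {0} (hvec ▸ eval_quartic_triple t u)
  · obtain ⟨i, j, hij, rfl⟩ := Finset.card_eq_two.1 hcard
    obtain ⟨σ, rfl, rfl⟩ := exists_perm_of_ne hij
    have hvec : zeroVec t u {0, 1} = ![u, u, 1, 1] := by
      ext i
      fin_cases i <;> simp [zeroVec]
    simpa [Finset.map_insert] using hmap σ {0, 1} (hvec ▸ eval_quartic_pair t hu)

theorem exists_eq_smul_zeroVec_of_quarticFun_diag_eq_zero {t u x y z : ℝ} (ht : t ≠ 1)
    (hu : u ≠ 0) (hV : 0 < VF t (omega u)) (h : quarticFun t (omega u) x x y z = 0) :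
    ∃ S ∈ zeroIndex, ∃ r : ℝ, ![x, x, y, z] = r • zeroVec t u S := by
  rcases cases_of_quarticFun_diag_eq_zero ht hV h with ⟨rfl, hq⟩ | ⟨rfl, rfl⟩ | ⟨rfl, rfl⟩
  · have hfac : (y - u * x) * (u * y - x) = 0 := by
      linear_combination u * hq + y * x * omega_mul_self hu
    rcases mul_eq_zero.1 hfac with hyx | hyx
    · obtain rfl : y = u * x := by linarith
      refine ⟨{2, 3}, by decide, x, ?_⟩
      ext i
      fin_cases i <;> simp [zeroVec, mul_comm]
    · obtain rfl : x = u * y := by linarith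
      refine ⟨{0, 1}, by decide, y, ?_⟩
      ext i
      fin_cases i <;> simp [zeroVec, mul_comm]
  · refine ⟨{3}, by decide, y, ?_⟩
    ext i
    fin_cases i <;> simp [zeroVec, mul_comm]
  · refine ⟨{2}, by decide, z, ?_⟩
    ext i
    fin_cases i <;> simp [zeroVec, mul_comm]

theorem exists_eq_smul_zeroVec_of_eval_eq_zero {t u : ℝ} (ht : t ≠ 1) (hu : u ≠ 0)
    (hV : 0 < VF t (omega u)) {v : Fin 4 → ℝ} (h : eval v (quartic t u) = 0) :
    ∃ S ∈ zeroIndex, ∃ r : ℝ, v = r • zeroVec t u S := by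
  obtain ⟨σ, hσ⟩ := exists_perm_eq_or_lt v
  rw [eval_quartic_perm t u v σ] at h
  replace h := (mul_eq_zero.1 h).resolve_left (pow_ne_zero 2 hu)
  rcases hσ with heq | ⟨h₀₁, h₁₂, h₂₃⟩
  · rw [← heq] at h
    obtain ⟨S, hS, r, hr⟩ := exists_eq_smul_zeroVec_of_quarticFun_diag_eq_zero ht hu hV h
    refine ⟨S.map σ.toEmbedding, by simpa [mem_zeroIndex] using hS, r,
      σ.surjective.injective_comp_right ?_⟩
    calc v ∘ σ = ![v (σ 0), v (σ 0), v (σ 2), v (σ 3)] := by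
          ext i
          fin_cases i <;> simp [heq]
      _ = (r • zeroVec t u (S.map σ.toEmbedding)) ∘ σ := by
          rw [hr, ← zeroVec_map_comp t u S σ]
          rfl
  · exact absurd h (quarticFun_pos_of_lt ht hV h₀₁ h₁₂ h₂₃).ne'

/-- The projective point of `zeroVec t u S`. -/
def zeroPoint (t : ℝ) {u : ℝ} (hu : u ≠ 0) (S : Finset (Fin 4)) : RealProj 4 :=
  Projectivization.mk ℝ (zeroVec t u S) (zeroVec_ne_zero t hu S)

theorem realZeros_quartic {t u : ℝ} (ht : t ≠ 1) (hu : u ≠ 0) (hV : 0 < VF t (omega u)) :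
    realZeros (quartic t u) = zeroPoint t hu '' (zeroIndex : Set (Finset (Fin 4))) := by
  ext p
  induction p using Projectivization.ind with | h v hv =>
  rw [mk_mem_realZeros_iff (isHomogeneous_quartic t u), Set.mem_image]
  constructor
  · intro h
    obtain ⟨S, hS, r, hr⟩ := exists_eq_smul_zeroVec_of_eval_eq_zero ht hu hV h
    exact ⟨S, hS, ((Projectivization.mk_eq_mk_iff' ℝ _ _ _ _).2 ⟨r, hr.symm⟩).symm⟩
  · rintro ⟨S, hS, h⟩
    rw [← mk_mem_realZeros_iff (isHomogeneous_quartic t u) hv, ← h, zeroPoint,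
      mk_mem_realZeros_iff (isHomogeneous_quartic t u)]
    exact eval_zeroVec t hu hS

theorem zeroVec_apply_eq_iff {t u : ℝ} (ht : t ≠ 1) (hu1 : u ≠ 1) (S : Finset (Fin 4))
    (i j : Fin 4) : zeroVec t u S i = zeroVec t u S j ↔ (i ∈ S ↔ j ∈ S) := by
  have hne : (if S.card = 1 then t else u) ≠ 1 := by split_ifs <;> assumption
  by_cases hi : i ∈ S <;> by_cases hj : j ∈ S <;> simp [zeroVec, hi, hj, hne, hne.symm]

theorem eq_or_eq_compl_of_mem_iff {α : Type*} [Fintype α] [DecidableEq α] {S T : Finset α}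
    (h : ∀ i j, (i ∈ S ↔ j ∈ S) ↔ (i ∈ T ↔ j ∈ T)) : S = T ∨ S = Tᶜ := by
  by_cases hST : ∃ i, i ∈ S ↔ i ∈ T
  · obtain ⟨i, hi⟩ := hST
    exact .inl (Finset.ext fun j => by have := h i j; tauto)
  · push Not at hST
    exact .inr (Finset.ext fun j => by have := hST j; rw [Finset.mem_compl]; tauto)

theorem smul_zeroVec_compl_ne {t u : ℝ} (hu1 : u ≠ 1) (hu2 : u ≠ -1) {S : Finset (Fin 4)}
    (hS : S ∈ zeroIndex) (hSc : Sᶜ ∈ zeroIndex) (r : ℝ) :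
    r • zeroVec t u Sᶜ ≠ zeroVec t u S := by
  intro h
  rw [mem_zeroIndex, Finset.card_compl, Fintype.card_fin] at hSc
  rw [mem_zeroIndex] at hS
  have hcard : S.card = 2 := by omega
  have hcard' : Sᶜ.card = 2 := by rw [Finset.card_compl, Fintype.card_fin, hcard]
  obtain ⟨i, hi⟩ : S.Nonempty := Finset.card_pos.1 (by omega)
  obtain ⟨j, hj⟩ : Sᶜ.Nonempty := Finset.card_pos.1 (by omega)
  have hri : r = u := by simpa [zeroVec, hi, hcard] using congrFun h i
  have hrj : r * u = 1 := by
    simpa [zeroVec, Finset.mem_compl.1 hj, hcard'] using congrFun h j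
  rcases mul_self_eq_one_iff.1 (hri ▸ hrj) with h1 | h1
  · exact hu1 h1
  · exact hu2 h1

theorem zeroPoint_injOn {t u : ℝ} (ht : t ≠ 1) (hu : u ≠ 0) (hu1 : u ≠ 1) (hu2 : u ≠ -1) :
    Set.InjOn (zeroPoint t hu) (zeroIndex : Set (Finset (Fin 4))) := by
  intro S hS T hT h
  obtain ⟨r, hr⟩ := (Projectivization.mk_eq_mk_iff' ℝ _ _ _ _).1 h
  have hr0 : r ≠ 0 := by
    rintro rfl
    exact zeroVec_ne_zero t hu S (by rw [← hr, zero_smul])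
  have hmem (i j : Fin 4) : (i ∈ T ↔ j ∈ T) ↔ (i ∈ S ↔ j ∈ S) := by
    rw [← zeroVec_apply_eq_iff ht hu1, ← zeroVec_apply_eq_iff ht hu1, ← hr, Pi.smul_apply,
      Pi.smul_apply, smul_right_inj hr0]
  rcases eq_or_eq_compl_of_mem_iff hmem with rfl | rfl
  · rfl
  · exact absurd hr (smul_zeroVec_compl_ne hu1 hu2 hS hT r)

theorem ncard_realZeros_quartic {t u : ℝ} (ht : t ≠ 1) (hu : u ≠ 0) (hu1 : u ≠ 1) (hu2 : u ≠ -1)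
    (hV : 0 < VF t (omega u)) : (realZeros (quartic t u)).ncard = 10 := by
  rw [realZeros_quartic ht hu hV, (zeroPoint_injOn ht hu hu1 hu2).ncard_image,
    Set.ncard_coe_finset]
  decide

theorem isDiscrete_realZeros_quartic {t u : ℝ} (ht : t ≠ 1) (hu : u ≠ 0)
    (hV : 0 < VF t (omega u)) : IsDiscrete (realZeros (quartic t u)) := by
  rw [realZeros_quartic ht hu hV]
  exact (zeroIndex.finite_toSet.image _).isDiscrete

/-! ### Quaternary forms by coefficients -/

theorem sum_antidiagonalTuple_succ {M : Type*} [AddCommMonoid M] (k n : ℕ)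
    (F : (Fin (k + 1) → ℕ) → M) :
    ∑ m ∈ Finset.Nat.antidiagonalTuple (k + 1) n, F m
      = ∑ p ∈ Finset.HasAntidiagonal.antidiagonal n,
          ∑ m ∈ Finset.Nat.antidiagonalTuple k p.2, F (Fin.cons p.1 m) := by
  change (((List.Nat.antidiagonal n).flatMap fun p =>
      (List.Nat.antidiagonalTuple k p.2).map (Fin.cons p.1)).map F).sum
    = ((List.Nat.antidiagonal n).map fun p =>
      ((List.Nat.antidiagonalTuple k p.2).map fun m => F (Fin.cons p.1 m)).sum).sum
  rw [List.flatMap_def, List.map_flatten, List.sum_flatten, List.map_map, List.map_map]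
  simp only [Function.comp_def, List.map_map]

theorem eval_eq_sum_antidiagonalTuple {R : Type*} [CommSemiring R] {k n : ℕ}
    {G : MvPolynomial (Fin n) R} (hG : G.IsHomogeneous k) (v : Fin n → R) :
    eval v G = ∑ m ∈ Finset.Nat.antidiagonalTuple n k,
      coeff (Finsupp.equivFunOnFinite.symm m) G * ∏ i, v i ^ m i := by
  rw [eval_eq']
  refine Finset.sum_of_injOn (fun m => (m : Fin n → ℕ)) DFunLike.coe_injective.injOn ?_ ?_
    fun m _ => by simp
  · intro m hm
    rw [SetLike.mem_coe, Finset.Nat.mem_antidiagonalTuple, ← Finsupp.degree_eq_sum,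
      hG.degree_eq_sum_deg_support hm, Finsupp.degree_apply]
  · intro m _ hm
    have hcoeff : coeff (Finsupp.equivFunOnFinite.symm m) G = 0 := by
      by_contra h
      exact hm ⟨_, mem_support_iff.2 h, by simp⟩
    rw [hcoeff, zero_mul]

/-- The coefficient of `a^i b^j c^k d^l` in a quaternary polynomial. -/
def coeff4 {R : Type*} [CommSemiring R] (G : MvPolynomial (Fin 4) R) (i j k l : ℕ) : R :=
  coeff (Finsupp.equivFunOnFinite.symm ![i, j, k, l]) G

theorem eval_eq_sum_coeff4 {R : Type*} [CommSemiring R] {n : ℕ} {G : MvPolynomial (Fin 4) R}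
    (hG : G.IsHomogeneous n) (a b c d : R) :
    eval ![a, b, c, d] G =
      ∑ i ∈ Finset.range (n + 1), ∑ j ∈ Finset.range (n - i + 1),
        ∑ k ∈ Finset.range (n - i - j + 1),
          coeff4 G i j k (n - i - j - k) * (a ^ i * b ^ j * c ^ k * d ^ (n - i - j - k)) := by
  simp only [eval_eq_sum_antidiagonalTuple hG, sum_antidiagonalTuple_succ,
    Finset.Nat.antidiagonalTuple_one, Finset.sum_singleton,
    Finset.Nat.sum_antidiagonal_eq_sum_range_succ_mk, Fin.prod_univ_four]
  rfl

theorem coeff_eq_of_rename_eq {σ R : Type*} [CommSemiring R] [Finite σ] {G : MvPolynomial σ R}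
    {e : Equiv.Perm σ} (h : rename e G = G) (m : σ → ℕ) :
    coeff (Finsupp.equivFunOnFinite.symm (m ∘ e)) G =
      coeff (Finsupp.equivFunOnFinite.symm m) G := by
  rw [← coeff_rename_mapDomain e e.injective G, h]
  congr 1
  ext i
  obtain ⟨j, rfl⟩ := e.surjective i
  rw [Finsupp.mapDomain_apply e.injective]
  rfl

theorem eq_of_forall_eval_fin_four {R : Type*} [CommRing R] [IsDomain R] [Infinite R]
    {G H : MvPolynomial (Fin 4) R}
    (h : ∀ a b c d, eval ![a, b, c, d] G = eval ![a, b, c, d] H) : G = H :=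
  MvPolynomial.funext fun v =>
    (FinVec.etaExpand_eq v).symm ▸ h (v 0) (v 1) (v 2) (v 3)

theorem eval_rename_swap_zero_one {R : Type*} [CommSemiring R] (G : MvPolynomial (Fin 4) R)
    (a b c d : R) :
    eval ![a, b, c, d] (rename (Equiv.swap (0 : Fin 4) 1) G) = eval ![b, a, c, d] G := by
  rw [eval_rename]
  congr 2
  funext i
  fin_cases i <;> rfl

theorem eval_rename_swap_two_three {R : Type*} [CommSemiring R] (G : MvPolynomial (Fin 4) R)
    (a b c d : R) :
    eval ![a, b, c, d] (rename (Equiv.swap (2 : Fin 4) 3) G) = eval ![a, b, d, c] G := by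
  rw [eval_rename]
  congr 2
  funext i
  fin_cases i <;> rfl

theorem exists_eq_of_antisymm_antisymm {G : MvPolynomial (Fin 4) ℝ} (hG : G.IsHomogeneous 4)
    (h₀₁ : rename (Equiv.swap (0 : Fin 4) 1) G = -G)
    (h₂₃ : rename (Equiv.swap (2 : Fin 4) 3) G = -G) :
    ∃ α β γ δ ε : ℝ, G = ((X 0 - X 1) * (X 2 - X 3)) *
      (C α * (X 0 ^ 2 + X 1 ^ 2) + C β * (X 0 * X 1) + C γ * (X 2 ^ 2 + X 3 ^ 2)
        + C δ * (X 2 * X 3) + C ε * ((X 0 + X 1) * (X 2 + X 3))) := by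
  have hswap₀₁ (a b c d) : eval ![b, a, c, d] G = -eval ![a, b, c, d] G := by
    rw [← eval_rename_swap_zero_one, h₀₁, map_neg]
  have hswap₂₃ (a b c d) : eval ![a, b, d, c] G = -eval ![a, b, c, d] G := by
    rw [← eval_rename_swap_two_three, h₂₃, map_neg]
  have havg (a b c d) : eval ![a, b, c, d] G = (eval ![a, b, c, d] G - eval ![b, a, c, d] G
      - eval ![a, b, d, c] G + eval ![b, a, d, c] G) / 4 := by
    rw [hswap₀₁ a b d c, hswap₀₁ a b c d, hswap₂₃ a b c d]
    ring
  set κ := coeff4 G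
  refine ⟨(κ 3 0 1 0 - κ 0 3 1 0 - κ 3 0 0 1 + κ 0 3 0 1) / 4,
    (κ 3 0 1 0 - κ 0 3 1 0 - κ 3 0 0 1 + κ 0 3 0 1 + κ 2 1 1 0 - κ 1 2 1 0 - κ 2 1 0 1
      + κ 1 2 0 1) / 4,
    (κ 1 0 3 0 - κ 0 1 3 0 - κ 1 0 0 3 + κ 0 1 0 3) / 4,
    (κ 1 0 3 0 - κ 0 1 3 0 - κ 1 0 0 3 + κ 0 1 0 3 + κ 1 0 2 1 - κ 0 1 2 1 - κ 1 0 1 2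
      + κ 0 1 1 2) / 4,
    (κ 2 0 2 0 - κ 0 2 2 0 - κ 2 0 0 2 + κ 0 2 0 2) / 4,
    eq_of_forall_eval_fin_four fun a b c d => ?_⟩
  rw [havg]
  simp only [eval_eq_sum_coeff4 hG, Finset.sum_range_succ, Finset.sum_range_zero, map_add, map_sub,
    map_mul, map_pow, eval_X, eval_C, Matrix.cons_val, Nat.reduceAdd, Nat.reduceSub]
  ring

theorem exists_eq_of_antisymm_symm {G : MvPolynomial (Fin 4) ℝ} (hG : G.IsHomogeneous 4)
    (h₀₁ : rename (Equiv.swap (0 : Fin 4) 1) G = -G)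
    (h₂₃ : rename (Equiv.swap (2 : Fin 4) 3) G = G) :
    ∃ α β γ δ ε ζ η θ : ℝ, G = (X 0 - X 1) *
      (C α * (X 0 + X 1) ^ 3 + C β * ((X 0 + X 1) * (X 0 * X 1))
        + C γ * ((X 0 + X 1) ^ 2 * (X 2 + X 3)) + C δ * ((X 0 * X 1) * (X 2 + X 3))
        + C ε * ((X 0 + X 1) * (X 2 + X 3) ^ 2) + C ζ * ((X 0 + X 1) * (X 2 * X 3))
        + C η * (X 2 + X 3) ^ 3 + C θ * ((X 2 + X 3) * (X 2 * X 3))) := by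
  have hswap₀₁ (a b c d) : eval ![b, a, c, d] G = -eval ![a, b, c, d] G := by
    rw [← eval_rename_swap_zero_one, h₀₁, map_neg]
  have hswap₂₃ (a b c d) : eval ![a, b, d, c] G = eval ![a, b, c, d] G := by
    rw [← eval_rename_swap_two_three, h₂₃]
  have havg (a b c d) : eval ![a, b, c, d] G = (eval ![a, b, c, d] G - eval ![b, a, c, d] G
      + eval ![a, b, d, c] G - eval ![b, a, d, c] G) / 4 := by
    rw [hswap₀₁ a b d c, hswap₀₁ a b c d, hswap₂₃ a b c d]
    ring
  set κ := coeff4 G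
  set γ := (κ 3 0 1 0 - κ 0 3 1 0 + κ 3 0 0 1 - κ 0 3 0 1) / 4
  set ε := (κ 2 0 2 0 - κ 0 2 2 0 + κ 2 0 0 2 - κ 0 2 0 2) / 4
  set η := (κ 1 0 3 0 - κ 0 1 3 0 + κ 1 0 0 3 - κ 0 1 0 3) / 4
  refine ⟨(κ 4 0 0 0 - κ 0 4 0 0) / 2,
    (κ 3 1 0 0 - κ 1 3 0 0) / 2 - (κ 4 0 0 0 - κ 0 4 0 0),
    γ, (κ 2 1 1 0 - κ 1 2 1 0 + κ 2 1 0 1 - κ 1 2 0 1) / 4 - γ,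
    ε, (κ 2 0 1 1 - κ 0 2 1 1) / 2 - 2 * ε,
    η, (κ 1 0 2 1 - κ 0 1 2 1 + κ 1 0 1 2 - κ 0 1 1 2) / 4 - 3 * η,
    eq_of_forall_eval_fin_four fun a b c d => ?_⟩
  rw [havg]
  simp only [eval_eq_sum_coeff4 hG, Finset.sum_range_succ, Finset.sum_range_zero, map_add, map_sub,
    map_mul, map_pow, eval_X, eval_C, Matrix.cons_val, Nat.reduceAdd, Nat.reduceSub]
  ring

/-- The symmetric quartic form with the given coordinates in the basis `s₀, …, s₄`. -/
def symCombination (x₀ x₁ x₂ x₃ x₄ : ℝ) : MvPolynomial (Fin 4) ℝ :=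
  C x₀ * s0 + C x₁ * s1 + C x₂ * s2 + C x₃ * s3 + C x₄ * s4

theorem exists_eq_of_isSymmetric {G : MvPolynomial (Fin 4) ℝ} (hG : G.IsHomogeneous 4)
    (hsymm : G.IsSymmetric) : ∃ x₀ x₁ x₂ x₃ x₄ : ℝ, G = symCombination x₀ x₁ x₂ x₃ x₄ := by
  have hperm (e : Equiv.Perm (Fin 4)) {m n : Fin 4 → ℕ} (hmn : ∀ r, m (e r) = n r) :
      coeff (Finsupp.equivFunOnFinite.symm n) G = coeff (Finsupp.equivFunOnFinite.symm m) G :=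
    _root_.funext hmn ▸ coeff_eq_of_rename_eq (hsymm e) m
  have h₀₁ (i j k l) : coeff4 G i j k l = coeff4 G j i k l :=
    hperm (Equiv.swap 0 1) fun r => by fin_cases r <;> rfl
  have h₁₂ (i j k l) : coeff4 G i j k l = coeff4 G i k j l :=
    hperm (Equiv.swap 1 2) fun r => by fin_cases r <;> rfl
  have h₂₃ (i j k l) : coeff4 G i j k l = coeff4 G i j l k :=
    hperm (Equiv.swap 2 3) fun r => by fin_cases r <;> rfl
  refine ⟨coeff4 G 0 0 0 4, coeff4 G 0 0 1 3, coeff4 G 0 0 2 2, coeff4 G 0 1 1 2,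
    coeff4 G 1 1 1 1 + 4 * coeff4 G 0 0 0 4 + 12 * coeff4 G 0 0 1 3 + 6 * coeff4 G 0 0 2 2
      + 12 * coeff4 G 0 1 1 2, eq_of_forall_eval_fin_four fun a b c d => ?_⟩
  simp only [eval_eq_sum_coeff4 hG, Finset.sum_range_succ, Finset.sum_range_zero, symCombination,
    s0, s1, s2, s3, s4, S4, U4, S22_eq, T31_eq, T211_eq, Fin.sum_univ_four, map_add, map_sub,
    map_mul, map_pow, eval_X, eval_C, map_ofNat, Matrix.cons_val, Nat.reduceAdd, Nat.reduceSub]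
  simp only [h₀₁, h₁₂, h₂₃]
  ring

/-! ### Double zeros -/

/-- `z` is a double zero of `G`: the polynomial and its first partial derivatives vanish at `z`. -/
def IsDoubleZero {σ R : Type*} [CommSemiring R] (z : σ → R) (G : MvPolynomial σ R) : Prop :=
  eval z G = 0 ∧ ∀ i, eval z (pderiv i G) = 0

theorem hasDerivAt_eval_update {σ 𝕜 : Type*} [DecidableEq σ] [NontriviallyNormedField 𝕜]
    (G : MvPolynomial σ 𝕜) (z : σ → 𝕜) (i : σ) :
    HasDerivAt (fun s => eval (Function.update z i s) G) (eval z (pderiv i G)) (z i) := by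
  induction G using MvPolynomial.induction_on with
  | C r => simpa only [eval_C, pderiv_C, map_zero] using hasDerivAt_const (z i) r
  | add p q hp hq => simpa only [map_add] using hp.fun_add hq
  | mul_X p j hp =>
    have hX : HasDerivAt (fun s => Function.update z i s j) (if j = i then 1 else 0) (z i) := by
      split_ifs with hj
      · simpa only [hj, Function.update_self] using hasDerivAt_id' (z i)
      · simpa only [Function.update_of_ne hj] using hasDerivAt_const (z i) (z j)
    simpa only [map_mul, eval_X, pderiv_mul, map_add, pderiv_X, Function.update_eq_self,
      Pi.single_apply, apply_ite, map_one, map_zero, eq_comm (a := i)] using hp.fun_mul hX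

theorem isDoubleZero_of_nonneg {σ : Type*} {z : σ → ℝ} {G : MvPolynomial σ ℝ}
    (h : ∀ x, 0 ≤ eval x G) (hz : eval z G = 0) : IsDoubleZero z G := by
  classical
  refine ⟨hz, fun i => IsLocalMin.hasDerivAt_eq_zero (.of_forall fun s => ?_)
    (hasDerivAt_eval_update G z i)⟩
  rw [Function.update_eq_self, hz]
  exact h _

theorem IsDoubleZero.rename {σ R : Type*} [CommSemiring R] {z : σ → R} {G : MvPolynomial σ R}
    {e : Equiv.Perm σ} (h : IsDoubleZero (z ∘ e) G) : IsDoubleZero z (rename e G) := by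
  refine ⟨by rw [eval_rename, h.1], fun i => ?_⟩
  obtain ⟨j, rfl⟩ := e.surjective i
  rw [pderiv_rename e.injective, eval_rename, h.2]

theorem IsDoubleZero.of_mul {σ R : Type*} [CommSemiring R] [NoZeroDivisors R] {z : σ → R}
    {G H : MvPolynomial σ R} (h : IsDoubleZero z (G * H)) (hG : eval z G ≠ 0) :
    IsDoubleZero z H := by
  have hH : eval z H = 0 := (mul_eq_zero.1 ((map_mul _ _ _).symm.trans h.1)).resolve_left hG
  refine ⟨hH, fun i => ?_⟩
  have hderiv := h.2 i
  rw [pderiv_mul, map_add, map_mul, map_mul, hH, mul_zero, zero_add] at hderiv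
  exact (mul_eq_zero.1 hderiv).resolve_left hG

theorem IsDoubleZero.eval_eq_zero_of_mul {σ R : Type*} [CommSemiring R] [NoZeroDivisors R]
    {z : σ → R} {G H : MvPolynomial σ R} (h : IsDoubleZero z (G * H)) (hG : eval z G = 0) {i : σ}
    (hi : eval z (pderiv i G) ≠ 0) : eval z H = 0 := by
  have hderiv := h.2 i
  rw [pderiv_mul, map_add, map_mul, map_mul, hG, zero_mul, add_zero] at hderiv
  exact (mul_eq_zero.1 hderiv).resolve_left hi

/-- The forms of degree `d` with double zeros at all points of `Z`. -/
def doubleZeroForms {σ R : Type*} [CommSemiring R] (d : ℕ) (Z : Set (σ → R)) :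
    Submodule R (MvPolynomial σ R) where
  carrier := {G | G.IsHomogeneous d ∧ ∀ z ∈ Z, IsDoubleZero z G}
  add_mem' {G H} hG hH := ⟨hG.1.add hH.1, fun z hz =>
    ⟨by rw [map_add, (hG.2 z hz).1, (hH.2 z hz).1, add_zero],
      fun i => by rw [map_add, map_add, (hG.2 z hz).2, (hH.2 z hz).2, add_zero]⟩⟩
  zero_mem' := ⟨isHomogeneous_zero _ _ _, fun z _ => ⟨map_zero _, fun i => by simp only [map_zero]⟩⟩
  smul_mem' r G hG := ⟨smul_eq_C_mul G r ▸ hG.1.C_mul r, fun z hz =>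
    ⟨by rw [smul_eval, (hG.2 z hz).1, mul_zero],
      fun i => by rw [Derivation.map_smul, smul_eval, (hG.2 z hz).2, mul_zero]⟩⟩

theorem rename_mem_doubleZeroForms {σ R : Type*} [CommSemiring R] {d : ℕ} {Z : Set (σ → R)}
    {G : MvPolynomial σ R} (hG : G ∈ doubleZeroForms d Z) {e : Equiv.Perm σ}
    (he : ∀ z ∈ Z, z ∘ e ∈ Z) : rename e G ∈ doubleZeroForms d Z :=
  ⟨hG.1.rename_isHomogeneous, fun z hz => (hG.2 _ (he z hz)).rename⟩

theorem mem_extremals_of_doubleZeroForms {n d : ℕ} {f : MvPolynomial (Fin n) ℝ} (hf : f ∈ PSD n d)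
    (hf0 : f ≠ 0) (hmul : ∀ G ∈ doubleZeroForms d {z | eval z f = 0}, ∃ c : ℝ, G = c • f) :
    f ∈ extremals (PSD n d) := by
  -- a nonnegative summand of `f` vanishes wherever `f` does, hence to second order
  have hsummand : ∀ g ∈ PSD n d, ∀ h ∈ PSD n d, g + h = f → ∃ c : ℝ, 0 ≤ c ∧ g = c • f := by
    intro g hg h hh hgh
    obtain ⟨c, hc⟩ := hmul g ⟨hg.1, fun z hz =>
      isDoubleZero_of_nonneg (fun x => hg.2 x trivial) <| by
        have hsum : eval z g + eval z h = 0 := by rw [← map_add, hgh, hz]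
        linarith [hg.2 z trivial, hh.2 z trivial]⟩
    obtain ⟨x, hx⟩ : ∃ x, eval x f ≠ 0 := by
      by_contra! hzero
      exact hf0 (MvPolynomial.funext fun x => by rw [hzero x, map_zero])
    refine ⟨c, nonneg_of_mul_nonneg_left ?_ ((hf.2 x trivial).lt_of_ne' hx), hc⟩
    simpa only [hc, smul_eval] using hg.2 x trivial
  exact ⟨hf, hf0, fun g hg h hh hgh =>
    ⟨hsummand g hg h hh hgh, hsummand h hh g hg (add_comm h g ▸ hgh)⟩⟩

/-! ### Extremality -/

/-- The quartic forms with double zeros at all the points `zeroVec t u S`. -/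
abbrev zeroVecForms (t u : ℝ) : Submodule ℝ (MvPolynomial (Fin 4) ℝ) :=
  doubleZeroForms 4 (zeroVec t u '' zeroIndex)

theorem rename_mem_zeroVecForms {t u : ℝ} {G : MvPolynomial (Fin 4) ℝ} (hG : G ∈ zeroVecForms t u)
    (e : Equiv.Perm (Fin 4)) : rename e G ∈ zeroVecForms t u := by
  refine rename_mem_doubleZeroForms hG ?_
  rintro _ ⟨S, hS, rfl⟩
  refine ⟨S.map e.symm.toEmbedding, ?_, ?_⟩
  · rw [Finset.mem_coe, mem_zeroIndex] at hS ⊢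
    rwa [Finset.card_map]
  · rw [← zeroVec_map_comp t u (S.map e.symm.toEmbedding) e, Finset.map_map]
    simp

theorem isDoubleZero_of_mem_zeroVecForms {t u : ℝ} {G : MvPolynomial (Fin 4) ℝ}
    (hG : G ∈ zeroVecForms t u) {v : Fin 4 → ℝ} (S : Finset (Fin 4))
    (hS : S ∈ zeroIndex := by decide) (hv : zeroVec t u S = v := by
      ext i; fin_cases i <;> simp [zeroVec]) : IsDoubleZero v G :=
  hv ▸ hG.2 _ ⟨S, hS, rfl⟩

theorem pderiv_ofNat {σ R : Type*} [CommSemiring R] (i : σ) (n : ℕ) [n.AtLeastTwo] :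
    pderiv i (ofNat(n) : MvPolynomial σ R) = 0 :=
  Derivation.map_natCast _ n

theorem eq_zero_of_antisymm_antisymm {t u : ℝ} (ht : t ≠ 1) (hu1 : u ≠ 1) (hu2 : u ≠ -1)
    {G : MvPolynomial (Fin 4) ℝ} (hG : G ∈ zeroVecForms t u)
    (h₀₁ : rename (Equiv.swap (0 : Fin 4) 1) G = -G)
    (h₂₃ : rename (Equiv.swap (2 : Fin 4) 3) G = -G) : G = 0 := by
  obtain ⟨α, β, γ, δ, ε, rfl⟩ := exists_eq_of_antisymm_antisymm hG.1 h₀₁ h₂₃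
  have ht' : t - 1 ≠ 0 := sub_ne_zero.2 ht
  have hu1' : u - 1 ≠ 0 := sub_ne_zero.2 hu1
  have hu2' : u + 1 ≠ 0 := fun h => hu2 (eq_neg_of_add_eq_zero_left h)
  have hpair := (isDoubleZero_of_mem_zeroVecForms hG (v := ![u, 1, u, 1]) {0, 2}).of_mul
    (by simp [hu1'])
  have htriple := (isDoubleZero_of_mem_zeroVecForms hG (v := ![t, 1, 1, 1]) {0}).eval_eq_zero_of_mul
    (by simp) (i := 2) (by simp [pderiv_X, ht'])
  have hd₀ : α * (2 * u) + β + ε * (u + 1) = 0 := by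
    simpa [pderiv_X, Pi.single_apply] using hpair.2 0
  have hd₁ : α * 2 + β * u + ε * (u + 1) = 0 := by
    simpa [pderiv_X, Pi.single_apply] using hpair.2 1
  have hd₂ : γ * (2 * u) + δ + ε * (u + 1) = 0 := by
    simpa [pderiv_X, Pi.single_apply] using hpair.2 2
  have hd₃ : γ * 2 + δ * u + ε * (u + 1) = 0 := by
    simpa [pderiv_X, Pi.single_apply] using hpair.2 3
  have ht₀ : α * (t ^ 2 + 1) + β * t + γ * 2 + δ + ε * ((t + 1) * 2) = 0 := by
    simpa [one_add_one_eq_two] using htriple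
  obtain rfl : β = 2 * α := mul_left_cancel₀ hu1' (by linear_combination hd₁ - hd₀)
  obtain rfl : δ = 2 * γ := mul_left_cancel₀ hu1' (by linear_combination hd₃ - hd₂)
  obtain rfl : ε = -2 * α := mul_left_cancel₀ hu2' (by linear_combination hd₀)
  obtain rfl : γ = α := mul_left_cancel₀ hu2' (by linear_combination (hd₂ - hd₀) / 2)
  obtain rfl : γ = 0 := mul_left_cancel₀ (pow_ne_zero 2 ht') (by linear_combination ht₀)
  simp

/-- The quadratic form in `a + b`, `c + d` and `cd` with the given coefficients, the shape of the
cofactor of `(a - b)(a + b - c - d)` in `exists_eq_mul_of_antisymm_symm`. -/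
def pairQuadric (α β γ δ : ℝ) : MvPolynomial (Fin 4) ℝ :=
  C α * (X 0 + X 1) ^ 2 + C β * ((X 0 + X 1) * (X 2 + X 3)) + C γ * (X 2 + X 3) ^ 2
    + C δ * (X 2 * X 3)

theorem eval_pairQuadric (α β γ δ : ℝ) (z : Fin 4 → ℝ) :
    eval z (pairQuadric α β γ δ) = α * (z 0 + z 1) ^ 2 + β * ((z 0 + z 1) * (z 2 + z 3))
      + γ * (z 2 + z 3) ^ 2 + δ * (z 2 * z 3) := by
  simp only [pairQuadric, map_add, map_mul, map_pow, eval_X, eval_C]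

theorem eval_pderiv_pairQuadric (α β γ δ : ℝ) (z : Fin 4 → ℝ) :
    eval z (pderiv 0 (pairQuadric α β γ δ)) = 2 * α * (z 0 + z 1) + β * (z 2 + z 3) := by
  simp only [pairQuadric, map_add, map_mul, map_pow, Derivation.leibniz, Derivation.leibniz_pow,
    pderiv_C, pderiv_X, Pi.single_apply, Fin.reduceEq, if_true, if_false, smul_eq_mul,
    nsmul_eq_mul, map_natCast, map_one, map_zero, eval_X, eval_C]
  ring

theorem exists_eq_mul_of_antisymm_symm {t u : ℝ} (ht : t ≠ 1) (hu1 : u ≠ 1) (hu2 : u ≠ -1)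
    {G : MvPolynomial (Fin 4) ℝ} (hG : G ∈ zeroVecForms t u)
    (h₀₁ : rename (Equiv.swap (0 : Fin 4) 1) G = -G)
    (h₂₃ : rename (Equiv.swap (2 : Fin 4) 3) G = G) :
    ∃ α β γ δ : ℝ,
      G = (X 0 - X 1) * ((X 0 + X 1 - X 2 - X 3) * pairQuadric α β γ δ) := by
  obtain ⟨α, β, γ, δ, ε, ζ, η, θ, rfl⟩ := exists_eq_of_antisymm_symm hG.1 h₀₁ h₂₃
  have ht' : t - 1 ≠ 0 := sub_ne_zero.2 ht
  have hu1' : u - 1 ≠ 0 := sub_ne_zero.2 hu1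
  have hu2' : u + 1 ≠ 0 := fun h => hu2 (eq_neg_of_add_eq_zero_left h)
  have hpair := (isDoubleZero_of_mem_zeroVecForms hG (v := ![u, 1, u, 1]) {0, 2}).of_mul
    (by simp [hu1'])
  have htriple := (isDoubleZero_of_mem_zeroVecForms hG (v := ![t, 1, 1, 1]) {0}).of_mul
    (by simp [ht'])
  have hd₀ : α * (3 * (u + 1) ^ 2) + β * (u + 1 + u) + γ * ((u + 1) * (2 * u + 2))
      + δ * (u + 1) + ε * (u + 1) ^ 2 + ζ * u = 0 := by
    simpa [pderiv_X, Pi.single_apply] using hpair.2 0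
  have hd₁ : α * (3 * (u + 1) ^ 2) + β * ((u + 1) * u + u) + γ * ((u + 1) * (2 * u + 2))
      + δ * ((u + 1) * u) + ε * (u + 1) ^ 2 + ζ * u = 0 := by
    simpa [pderiv_X, Pi.single_apply] using hpair.2 1
  have hd₂ : γ * (u + 1) ^ 2 + δ * u + ε * ((u + 1) * (2 * u + 2)) + ζ * (u + 1)
      + η * (3 * (u + 1) ^ 2) + θ * (u + 1 + u) = 0 := by
    simpa [pderiv_X, Pi.single_apply] using hpair.2 2
  have hd₃ : γ * (u + 1) ^ 2 + δ * u + ε * ((u + 1) * (2 * u + 2)) + ζ * ((u + 1) * u)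
      + η * (3 * (u + 1) ^ 2) + θ * ((u + 1) * u + u) = 0 := by
    simpa [pderiv_X, Pi.single_apply] using hpair.2 3
  have ht₀ : α * (3 * (t + 1) ^ 2) + β * (t + 1 + t) + γ * (2 * (2 * t + 2)) + δ * 2
      + ε * 2 ^ 2 + ζ = 0 := by
    simpa [pderiv_X, one_add_one_eq_two] using htriple.2 0
  have ht₁ : α * (3 * (t + 1) ^ 2) + β * ((t + 1) * t + t) + γ * (2 * (2 * t + 2)) + δ * (2 * t)
      + ε * 2 ^ 2 + ζ = 0 := by
    simpa [pderiv_X, one_add_one_eq_two] using htriple.2 1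
  obtain rfl : δ = -β :=
    mul_left_cancel₀ (mul_ne_zero hu1' hu2') (by linear_combination hd₁ - hd₀)
  obtain rfl : θ = -ζ :=
    mul_left_cancel₀ (mul_ne_zero hu1' hu2') (by linear_combination hd₃ - hd₂)
  obtain rfl : β = 0 := mul_left_cancel₀ (pow_ne_zero 2 ht') (by linear_combination ht₁ - ht₀)
  obtain rfl : η = -(α + γ + ε) := mul_left_cancel₀ (mul_ne_zero three_ne_zero (pow_ne_zero 2 hu2'))
    (by linear_combination hd₀ + hd₂)
  refine ⟨α, α + γ, α + γ + ε, ζ, ?_⟩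
  simp only [pairQuadric, map_add, map_neg, map_zero]
  ring

theorem eval_pderiv_sub_mul_sub (z : Fin 4 → ℝ) :
    eval z (pderiv 0 ((X 0 - X 1) * (X 0 + X 1 - X 2 - X 3))) = 2 * z 0 - z 2 - z 3 := by
  simp only [map_add, map_sub, map_mul, Derivation.leibniz, pderiv_X, Pi.single_apply,
    Fin.reduceEq, if_true, if_false, smul_eq_mul, map_one, map_zero, eval_X]
  ring

theorem two_mul_sub_ne_zero_or {t u : ℝ} (hu1 : u ≠ 1) (hu2 : u ≠ -1) :
    2 * u - (t + 1) ≠ 0 ∨ 2 - (t + 1) * u ≠ 0 := by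
  by_contra! h
  have husq : u ^ 2 = 1 := by linear_combination (u * h.1 - h.2) / 2
  exact (sq_eq_one_iff.1 husq).elim hu1 hu2

theorem eq_zero_of_antisymm_symm {t u : ℝ} (ht : t ≠ 1) (hu1 : u ≠ 1) (hu2 : u ≠ -1)
    {G : MvPolynomial (Fin 4) ℝ} (hG : G ∈ zeroVecForms t u)
    (h₀₁ : rename (Equiv.swap (0 : Fin 4) 1) G = -G)
    (h₂₃ : rename (Equiv.swap (2 : Fin 4) 3) G = G) : G = 0 := by
  obtain ⟨α, β, γ, δ, rfl⟩ := exists_eq_mul_of_antisymm_symm ht hu1 hu2 hG h₀₁ h₂₃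
  rw [← mul_assoc] at hG
  have ht' : t - 1 ≠ 0 := sub_ne_zero.2 ht
  have hu1' : u - 1 ≠ 0 := sub_ne_zero.2 hu1
  have htriple₀ := (isDoubleZero_of_mem_zeroVecForms hG (v := ![t, 1, 1, 1]) {0}).of_mul
    (by simp [ht'])
  have htriple₂ := (isDoubleZero_of_mem_zeroVecForms hG
    (v := ![1, 1, t, 1]) {2}).eval_eq_zero_of_mul (by simp) (i := 0)
    ((eval_pderiv_sub_mul_sub _).trans_ne
      (show 2 * 1 - t - 1 ≠ 0 from fun h => ht' (by linear_combination -h)))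
  have hpair₀₁ := (isDoubleZero_of_mem_zeroVecForms hG
    (v := ![u, u, 1, 1]) {0, 1}).eval_eq_zero_of_mul (by simp) (i := 0)
    ((eval_pderiv_sub_mul_sub _).trans_ne
      (show 2 * u - 1 - 1 ≠ 0 from fun h => hu1' (by linear_combination h / 2)))
  have hpair₂₃ := (isDoubleZero_of_mem_zeroVecForms hG
    (v := ![1, 1, u, u]) {2, 3}).eval_eq_zero_of_mul (by simp) (i := 0)
    ((eval_pderiv_sub_mul_sub _).trans_ne
      (show 2 * 1 - u - u ≠ 0 from fun h => hu1' (by linear_combination -h / 2)))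
  have hβ : 2 * (β + α * (t + 1)) = 0 :=
    Eq.trans (by simp only [eval_pderiv_pairQuadric, Matrix.cons_val]; ring) (htriple₀.2 0)
  obtain rfl : β = -(α * (t + 1)) := by linarith
  have h₀ : -(α * (t + 1) ^ 2) + 4 * γ + δ = 0 :=
    Eq.trans (by simp only [eval_pairQuadric, Matrix.cons_val]; ring) htriple₀.1
  obtain rfl : δ = α * (t + 1) ^ 2 - 4 * γ := by linarith
  have h₂ : (t - 1) ^ 2 * (α * (t + 2) + γ) = 0 :=
    Eq.trans (by simp only [eval_pairQuadric, Matrix.cons_val]; ring) htriple₂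
  have h₀₁ : α * (2 * u - (t + 1)) ^ 2 = 0 :=
    Eq.trans (by simp only [eval_pairQuadric, Matrix.cons_val]; ring) hpair₀₁
  have h₂₃ : α * (2 - (t + 1) * u) ^ 2 = 0 :=
    Eq.trans (by simp only [eval_pairQuadric, Matrix.cons_val]; ring) hpair₂₃
  obtain rfl : α = 0 := by
    rcases two_mul_sub_ne_zero_or (t := t) hu1 hu2 with h | h
    · exact (mul_eq_zero.1 h₀₁).resolve_right (pow_ne_zero 2 h)
    · exact (mul_eq_zero.1 h₂₃).resolve_right (pow_ne_zero 2 h)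
  obtain rfl : γ = 0 := by simpa [ht'] using h₂
  simp [pairQuadric]

section symCombination

variable (x₀ x₁ x₂ x₃ x₄ : ℝ)

theorem eval_one_symCombination : eval 1 (symCombination x₀ x₁ x₂ x₃ x₄) = x₄ := by
  simp only [symCombination, s0, s1, s2, s3, s4, U4, S4, S22_eq, T31_eq, T211_eq, Fin.sum_univ_four,
    map_add, map_sub, map_mul, map_pow, eval_X, eval_C, eval_ofNat, Pi.one_apply]
  ring

theorem eval_pair_symCombination (u : ℝ) :
    eval ![u, u, 1, 1] (symCombination x₀ x₁ x₂ x₃ x₄) =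
      (u - 1) ^ 2 * ((2 * x₀ + 2 * x₁ + x₂) * (u + 1) ^ 2 + 4 * (x₁ + x₃) * u) + x₄ * u ^ 2 := by
  simp only [symCombination, s0, s1, s2, s3, s4, U4, S4, S22_eq, T31_eq, T211_eq, Fin.sum_univ_four,
    map_add, map_sub, map_mul, map_pow, eval_X, eval_C, eval_ofNat, Matrix.cons_val]
  ring

theorem eval_pair_pderiv_symCombination (u : ℝ) :
    eval ![u, u, 1, 1] (pderiv 0 (symCombination x₀ x₁ x₂ x₃ x₄)) =
      (u - 1) * (2 * (2 * x₀ + 2 * x₁ + x₂) * u * (u + 1) + 2 * (x₁ + x₃) * (3 * u - 1))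
        + x₄ * u := by
  simp only [symCombination, s0, s1, s2, s3, s4, U4, S4, S22_eq, T31_eq, T211_eq, Fin.sum_univ_four,
    map_add, map_sub, map_mul, map_pow, Derivation.leibniz, Derivation.leibniz_pow, pderiv_C,
    pderiv_X, pderiv_ofNat, Pi.single_apply, Fin.reduceEq, if_true, if_false, smul_eq_mul,
    nsmul_eq_mul, map_natCast, map_one, map_zero, eval_X, eval_C, eval_ofNat, Matrix.cons_val]
  ring

theorem eval_triple_symCombination (t : ℝ) :
    eval ![t, 1, 1, 1] (symCombination x₀ x₁ x₂ x₃ x₄) =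
      (t - 1) ^ 2 * (x₀ * (t ^ 2 + 2 * t + 3) + 3 * x₁ * (t + 2) + 3 * x₂ + 3 * x₃) + x₄ * t := by
  simp only [symCombination, s0, s1, s2, s3, s4, U4, S4, S22_eq, T31_eq, T211_eq, Fin.sum_univ_four,
    map_add, map_sub, map_mul, map_pow, eval_X, eval_C, eval_ofNat, Matrix.cons_val]
  ring

theorem eval_triple_pderiv_symCombination (t : ℝ) :
    eval ![t, 1, 1, 1] (pderiv 0 (symCombination x₀ x₁ x₂ x₃ x₄)) =
      (t - 1) * (4 * x₀ * (t ^ 2 + t + 1) + 9 * x₁ * (t + 1) + 6 * x₂ + 6 * x₃) + x₄ := by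
  simp only [symCombination, s0, s1, s2, s3, s4, U4, S4, S22_eq, T31_eq, T211_eq, Fin.sum_univ_four,
    map_add, map_sub, map_mul, map_pow, Derivation.leibniz, Derivation.leibniz_pow, pderiv_C,
    pderiv_X, pderiv_ofNat, Pi.single_apply, Fin.reduceEq, if_true, if_false, smul_eq_mul,
    nsmul_eq_mul, map_natCast, map_one, map_zero, eval_X, eval_C, eval_ofNat, Matrix.cons_val]
  ring

end symCombination

theorem eq_zero_of_isSymmetric {t u : ℝ} (ht : t ≠ 1) (hu : u ≠ 0) (hu1 : u ≠ 1) (hu2 : u ≠ -1)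
    {G : MvPolynomial (Fin 4) ℝ} (hG : G ∈ zeroVecForms t u) (hsymm : G.IsSymmetric)
    (h1 : eval 1 G = 0) : G = 0 := by
  obtain ⟨x₀, x₁, x₂, x₃, x₄, rfl⟩ := exists_eq_of_isSymmetric hG.1 hsymm
  rw [eval_one_symCombination] at h1
  subst h1
  have ht' : t - 1 ≠ 0 := sub_ne_zero.2 ht
  have hu1' : u - 1 ≠ 0 := sub_ne_zero.2 hu1
  have hu2' : u + 1 ≠ 0 := fun h => hu2 (eq_neg_of_add_eq_zero_left h)
  have hpair := isDoubleZero_of_mem_zeroVecForms hG (v := ![u, u, 1, 1]) {0, 1}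
  have htriple := isDoubleZero_of_mem_zeroVecForms hG (v := ![t, 1, 1, 1]) {0}
  have hp := (eval_pair_symCombination x₀ x₁ x₂ x₃ 0 u).symm.trans hpair.1
  have hp₀ := (eval_pair_pderiv_symCombination x₀ x₁ x₂ x₃ 0 u).symm.trans (hpair.2 0)
  have hx₂ : 2 * x₀ + 2 * x₁ + x₂ = 0 :=
    mul_left_cancel₀ (mul_ne_zero hu2' (pow_ne_zero 4 hu1'))
      (by linear_combination 2 * u * (u - 1) * hp₀ - (3 * u - 1) * hp)
  have hx₃ : x₁ + x₃ = 0 :=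
    mul_left_cancel₀ (mul_ne_zero (mul_ne_zero four_ne_zero hu) (pow_ne_zero 2 hu1'))
      (by linear_combination hp - (u - 1) ^ 2 * (u + 1) ^ 2 * hx₂)
  obtain rfl : x₃ = -x₁ := by linarith
  obtain rfl : x₂ = -(2 * x₀ + 2 * x₁) := by linarith
  have ht₀ : (t - 1) ^ 3 * (x₀ * (t + 3) + 3 * x₁) = 0 := by
    linear_combination (eval_triple_symCombination _ _ _ _ _ t).symm.trans htriple.1
  have ht₁ : (t - 1) ^ 2 * (4 * x₀ * (t + 2) + 9 * x₁) = 0 := by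
    linear_combination (eval_triple_pderiv_symCombination _ _ _ _ _ t).symm.trans (htriple.2 0)
  obtain rfl : x₀ = 0 :=
    mul_left_cancel₀ (pow_ne_zero 4 ht') (by linear_combination (t - 1) * ht₁ - 3 * ht₀)
  obtain rfl : x₁ = 0 := by simpa [ht'] using ht₀
  simp [symCombination]

theorem rename_swap_rename_swap {σ R : Type*} [CommSemiring R] [DecidableEq σ] (i j : σ)
    (G : MvPolynomial σ R) : rename (Equiv.swap i j) (rename (Equiv.swap i j) G) = G := by
  rw [rename_rename, ← Equiv.coe_trans, Equiv.swap_swap, Equiv.coe_refl, rename_id_apply]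

theorem rename_swap_zero_one_eq {t u : ℝ} (ht : t ≠ 1) (hu1 : u ≠ 1) (hu2 : u ≠ -1)
    {G : MvPolynomial (Fin 4) ℝ} (hG : G ∈ zeroVecForms t u) :
    rename (Equiv.swap (0 : Fin 4) 1) G = G := by
  set ρ : MvPolynomial (Fin 4) ℝ →ₐ[ℝ] _ := rename (Equiv.swap (0 : Fin 4) 1)
  set τ : MvPolynomial (Fin 4) ℝ →ₐ[ℝ] _ := rename (Equiv.swap (2 : Fin 4) 3)
  have hτρ : ∀ F, τ (ρ F) = ρ (τ F) := fun F => by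
    rw [rename_rename, rename_rename, ← Equiv.coe_trans, ← Equiv.coe_trans]
    congr 3
    decide
  have hρρ : ∀ F, ρ (ρ F) = F := rename_swap_rename_swap 0 1
  have hττ : ∀ F, τ (τ F) = F := rename_swap_rename_swap 2 3
  have hH : G - ρ G ∈ zeroVecForms t u := sub_mem hG (rename_mem_zeroVecForms hG _)
  have hτH : τ (G - ρ G) ∈ zeroVecForms t u := rename_mem_zeroVecForms hH _
  have hρH : ρ (G - ρ G) = -(G - ρ G) := by rw [map_sub, hρρ, neg_sub]
  have hρτH : ρ (τ (G - ρ G)) = -τ (G - ρ G) := by rw [← hτρ, hρH, map_neg]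
  have hadd : G - ρ G + τ (G - ρ G) = 0 := eq_zero_of_antisymm_symm ht hu1 hu2 (add_mem hH hτH)
    ((map_add ρ _ _).trans (by rw [hρH, hρτH, neg_add]))
    ((map_add τ _ _).trans (by rw [hττ, add_comm]))
  have hsub : G - ρ G - τ (G - ρ G) = 0 := eq_zero_of_antisymm_antisymm ht hu1 hu2 (sub_mem hH hτH)
    ((map_sub ρ _ _).trans (by rw [hρH, hρτH, neg_sub_neg, neg_sub]))
    ((map_sub τ _ _).trans (by rw [hττ, neg_sub]))
  have htwo : (2 : ℝ) • (G - ρ G) = 0 := by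
    rw [two_smul]
    linear_combination hadd + hsub
  exact (sub_eq_zero.1 ((smul_eq_zero.1 htwo).resolve_left two_ne_zero)).symm

theorem isSymmetric_of_mem_zeroVecForms {t u : ℝ} (ht : t ≠ 1) (hu1 : u ≠ 1) (hu2 : u ≠ -1)
    {G : MvPolynomial (Fin 4) ℝ} (hG : G ∈ zeroVecForms t u) : G.IsSymmetric := by
  intro e
  induction e using Equiv.Perm.swap_induction_on with
  | one => exact rename_id_apply G
  | swap_mul e i j hij he =>
    obtain ⟨π, rfl, rfl⟩ := exists_perm_of_ne hij
    have hconj := rename_swap_zero_one_eq ht hu1 hu2 (rename_mem_zeroVecForms hG π⁻¹)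
    rw [Equiv.Perm.coe_mul, ← rename_rename, he, Equiv.swap_apply_apply, Equiv.Perm.coe_mul,
      Equiv.Perm.coe_mul, ← rename_rename, ← rename_rename, hconj, rename_rename,
      ← Equiv.Perm.coe_mul, mul_inv_cancel, Equiv.Perm.coe_one, rename_id_apply]

theorem eval_one_quartic (t u : ℝ) :
    eval 1 (quartic t u) = u ^ 2 * (2 * (t - 1) ^ 4 * omega u ^ 2) := by
  simp only [eval_quartic, quarticFun, p0, p1, p2, p3, p4, Pi.one_apply]
  ring

theorem quartic_mem_extremals {t u : ℝ} (ht : t ≠ 1) (hu : u ≠ 0) (hu1 : u ≠ 1) (hu2 : u ≠ -1)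
    (hV : 0 ≤ VF t (omega u)) : quartic t u ∈ extremals (PSD 4 4) := by
  have hne : eval 1 (quartic t u) ≠ 0 := by
    rw [eval_one_quartic]
    have hw : omega u ≠ 0 :=
      left_ne_zero_of_mul (omega_mul_self hu ▸ pow_ne_zero 2 (sub_ne_zero.2 hu1))
    have : t - 1 ≠ 0 := sub_ne_zero.2 ht
    positivity
  have hzero : zeroVec t u '' zeroIndex ⊆ {z | eval z (quartic t u) = 0} := by
    rintro _ ⟨S, hS, rfl⟩
    exact eval_zeroVec t hu hS
  have hmem : quartic t u ∈ zeroVecForms t u := ⟨isHomogeneous_quartic t u, fun z hz =>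
    isDoubleZero_of_nonneg (eval_quartic_nonneg hV) (hzero hz)⟩
  refine mem_extremals_of_doubleZeroForms
    ⟨isHomogeneous_quartic t u, fun v _ => eval_quartic_nonneg hV v⟩
    (fun h => hne (by rw [h, map_zero])) fun G hG => ?_
  set c := eval 1 G / eval 1 (quartic t u)
  have hsub : G - c • quartic t u ∈ zeroVecForms t u :=
    sub_mem ⟨hG.1, fun z hz => hG.2 z (hzero hz)⟩ (Submodule.smul_mem _ c hmem)
  refine ⟨c, sub_eq_zero.1 (eq_zero_of_isSymmetric ht hu hu1 hu2 hsub
    (isSymmetric_of_mem_zeroVecForms ht hu1 hu2 hsub) ?_)⟩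
  rw [map_sub, smul_eval, div_mul_cancel₀ _ hne, sub_self]

/-! ### Factors of homogeneous polynomials -/

theorem order_le_totalDegree {σ R : Type*} [CommSemiring R] {f : MvPolynomial σ R} (hf : f ≠ 0) :
    (f : MvPowerSeries σ R).order ≤ f.totalDegree := by
  obtain ⟨d, hd⟩ := ne_zero_iff.1 hf
  refine (MvPowerSeries.order_le (by rwa [coeff_coe])).trans ?_
  exact_mod_cast le_totalDegree (mem_support_iff.2 hd)

theorem isHomogeneous_totalDegree_of_le_order {σ R : Type*} [CommSemiring R]
    {f : MvPolynomial σ R} (h : f.totalDegree ≤ (f : MvPowerSeries σ R).order) :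
    f.IsHomogeneous f.totalDegree := by
  intro d hd
  refine (DFunLike.congr_fun Finsupp.degree_eq_weight_one d).symm.trans
    (le_antisymm (le_totalDegree (mem_support_iff.2 hd)) ?_)
  exact_mod_cast h.trans (MvPowerSeries.order_le (by rwa [coeff_coe]))

theorem le_order_of_isHomogeneous {σ R : Type*} [CommSemiring R] {f : MvPolynomial σ R} {k : ℕ}
    (hf : f.IsHomogeneous k) : k ≤ (f : MvPowerSeries σ R).order :=
  MvPowerSeries.nat_le_order fun d hd => by
    rw [coeff_coe]
    exact hf.coeff_eq_zero hd.ne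

-- Total degree and order are both additive on products, and `order ≤ totalDegree` with equality
-- exactly on homogeneous polynomials.
theorem isHomogeneous_totalDegree_of_mul {σ R : Type*} [CommRing R] [IsDomain R] {k : ℕ}
    {f g : MvPolynomial σ R} (hfg : (f * g).IsHomogeneous k) (h0 : f * g ≠ 0) :
    f.IsHomogeneous f.totalDegree := by
  have hf := left_ne_zero_of_mul h0
  have hg := right_ne_zero_of_mul h0
  have hdeg : f.totalDegree + g.totalDegree = k := by
    rw [← totalDegree_mul_of_isDomain hf hg, hfg.totalDegree h0]
  have hord := le_order_of_isHomogeneous hfg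
  rw [coe_mul, MvPowerSeries.order_mul, ← hdeg, Nat.cast_add] at hord
  have hcancel := hord.trans (add_le_add_right (order_le_totalDegree hg) _)
  exact isHomogeneous_totalDegree_of_le_order
    ((ENat.add_le_add_iff_right (ENat.natCast_ne_top _)).1 hcancel)

theorem exists_isHomogeneous_of_mul {σ R : Type*} [CommRing R] [IsDomain R] {k : ℕ}
    {f g : MvPolynomial σ R} (hfg : (f * g).IsHomogeneous k) (h0 : f * g ≠ 0) :
    ∃ i j, i + j = k ∧ f.IsHomogeneous i ∧ g.IsHomogeneous j := by
  have hf := isHomogeneous_totalDegree_of_mul hfg h0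
  have hg := isHomogeneous_totalDegree_of_mul (mul_comm f g ▸ hfg) (mul_comm f g ▸ h0)
  exact ⟨_, _, (hf.mul hg).inj_right hfg h0, hf, hg⟩

theorem exists_eq_C_of_isHomogeneous_zero {σ R : Type*} [CommSemiring R] {f : MvPolynomial σ R}
    (hf : f.IsHomogeneous 0) : ∃ r, f = C r :=
  ⟨_, totalDegree_eq_zero_iff_eq_C.1 ((totalDegree_zero_iff_isHomogeneous _).2 hf)⟩

theorem isUnit_iff_isHomogeneous_zero {σ K : Type*} [Field K] {f : MvPolynomial σ K}
    (h0 : f ≠ 0) : IsUnit f ↔ f.IsHomogeneous 0 := by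
  rw [isUnit_iff_totalDegree_of_isReduced, totalDegree_zero_iff_isHomogeneous,
    and_iff_right_iff_imp]
  intro hdeg
  obtain ⟨r, rfl⟩ := exists_eq_C_of_isHomogeneous_zero hdeg
  simpa using h0

theorem exists_eq_C_mul_of_dvd {σ R : Type*} [CommRing R] [IsDomain R] {k : ℕ}
    {p q : MvPolynomial σ R} (hp : p.IsHomogeneous k) (hq : q.IsHomogeneous k) (hp0 : p ≠ 0)
    (h : q ∣ p) : ∃ c, c ≠ 0 ∧ p = C c * q := by
  obtain ⟨s, rfl⟩ := h
  obtain ⟨i, j, hij, hi, hj⟩ := exists_isHomogeneous_of_mul hp hp0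
  obtain rfl : i = k := hi.inj_right hq (left_ne_zero_of_mul hp0)
  obtain rfl : j = 0 := by omega
  obtain ⟨c, rfl⟩ := exists_eq_C_of_isHomogeneous_zero hj
  exact ⟨c, C_ne_zero.1 (right_ne_zero_of_mul hp0), mul_comm _ _⟩

/-! ### Complex forms and their conjugates -/

theorem exists_isHomogeneous_re_im {σ : Type*} {k : ℕ} {p : MvPolynomial σ ℂ}
    (hp : p.IsHomogeneous k) : ∃ A B : MvPolynomial σ ℝ, A.IsHomogeneous k ∧ B.IsHomogeneous k ∧
      p = map (algebraMap ℝ ℂ) A + C Complex.I * map (algebraMap ℝ ℂ) B := by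
  have hdeg : ∀ d ∈ p.support, d.degree = k := fun d hd => by
    by_contra hne
    exact mem_support_iff.1 hd (hp.coeff_eq_zero hne)
  refine ⟨∑ d ∈ p.support, monomial d (coeff d p).re, ∑ d ∈ p.support, monomial d (coeff d p).im,
    IsHomogeneous.sum _ _ _ fun d hd => isHomogeneous_monomial _ (hdeg d hd),
    IsHomogeneous.sum _ _ _ fun d hd => isHomogeneous_monomial _ (hdeg d hd), ?_⟩
  simp only [map_sum, map_monomial, Finset.mul_sum, C_mul_monomial, ← Finset.sum_add_distrib,
    ← LinearMap.map_add, Complex.coe_algebraMap, mul_comm Complex.I, Complex.re_add_im,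
    support_sum_monomial_coeff]

theorem map_conj_map_ofReal {σ : Type*} (f : MvPolynomial σ ℝ) :
    map (starRingEnd ℂ) (map (algebraMap ℝ ℂ) f) = map (algebraMap ℝ ℂ) f := by
  have h : (starRingEnd ℂ).comp (algebraMap ℝ ℂ) = algebraMap ℝ ℂ :=
    RingHom.ext Complex.conj_ofReal
  rw [map_map, h]

theorem map_conj_map_conj {σ : Type*} (p : MvPolynomial σ ℂ) :
    map (starRingEnd ℂ) (map (starRingEnd ℂ) p) = p := by
  have h : (starRingEnd ℂ).comp (starRingEnd ℂ) = RingHom.id ℂ := RingHom.ext Complex.conj_conj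
  rw [map_map, h, map_id]

theorem map_conj_re_add_im {σ : Type*} (A B : MvPolynomial σ ℝ) :
    map (starRingEnd ℂ) (map (algebraMap ℝ ℂ) A + C Complex.I * map (algebraMap ℝ ℂ) B)
      = map (algebraMap ℝ ℂ) A - C Complex.I * map (algebraMap ℝ ℂ) B := by
  rw [map_add, map_mul, map_C, map_conj_map_ofReal, map_conj_map_ofReal, Complex.conj_I, C_neg,
    neg_mul, sub_eq_add_neg]

theorem exists_eq_C_mul_map_ofReal {σ : Type*} {k : ℕ} {p : MvPolynomial σ ℂ}
    (hp : p.IsHomogeneous k) {c : ℂ} (hc : map (starRingEnd ℂ) p = C c * p) :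
    ∃ D : MvPolynomial σ ℝ, D.IsHomogeneous k ∧
      ∃ r : ℂ, r ≠ 0 ∧ p = C r * map (algebraMap ℝ ℂ) D := by
  obtain ⟨A, B, hA, hB, rfl⟩ := exists_isHomogeneous_re_im hp
  rw [map_conj_re_add_im] at hc
  by_cases h : 1 + c = 0
  · have hA0 : map (algebraMap ℝ ℂ) A = 0 := by
      rw [eq_neg_of_add_eq_zero_right h, C_neg, C_1] at hc
      exact mul_left_cancel₀ two_ne_zero (by linear_combination hc)
    exact ⟨B, hB, Complex.I, Complex.I_ne_zero, by rw [hA0, zero_add]⟩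
  · refine ⟨A, hA, (1 + c)⁻¹ * 2, by simpa using h, ?_⟩
    have hinv : (C (1 + c)⁻¹ * (1 + C c) : MvPolynomial σ ℂ) = 1 := by
      rw [← C_1, ← C_add, ← C_mul, inv_mul_cancel₀ h]
    rw [C_mul, map_ofNat]
    linear_combination -C (1 + c)⁻¹ * hc - (map (algebraMap ℝ ℂ) A
      + C Complex.I * map (algebraMap ℝ ℂ) B) * hinv

/-! ### Real zeros of linear and quadratic forms -/

theorem exists_linearMap_eval_eq {σ R : Type*} [CommSemiring R] {f : MvPolynomial σ R}
    (hf : f.IsHomogeneous 1) : ∃ L : (σ → R) →ₗ[R] R, ∀ x, eval x f = L x := by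
  rw [← mem_homogeneousSubmodule, homogeneousSubmodule_one_eq_span_X] at hf
  induction hf using Submodule.span_induction with
  | mem f hf =>
    obtain ⟨i, rfl⟩ := hf
    exact ⟨LinearMap.proj i, fun x => eval_X i⟩
  | zero => exact ⟨0, fun x => map_zero _⟩
  | add f g _ _ hf hg =>
    obtain ⟨L, hL⟩ := hf
    obtain ⟨M, hM⟩ := hg
    exact ⟨L + M, fun x => by rw [map_add, hL, hM, LinearMap.add_apply]⟩
  | smul r f _ hf =>
    obtain ⟨L, hL⟩ := hf
    exact ⟨r • L, fun x => by rw [smul_eval, hL, LinearMap.smul_apply, smul_eq_mul]⟩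

theorem exists_quadraticMap_eval_eq {σ R : Type*} [CommRing R] {f : MvPolynomial σ R}
    (hf : f.IsHomogeneous 2) : ∃ Q : QuadraticForm R (σ → R), ∀ x, eval x f = Q x := by
  rw [← mem_homogeneousSubmodule, ← homogeneousSubmodule_one_pow, pow_two] at hf
  induction hf using Submodule.mul_induction_on' with
  | mem_mul_mem f hf g hg =>
    obtain ⟨L, hL⟩ := exists_linearMap_eval_eq hf
    obtain ⟨M, hM⟩ := exists_linearMap_eval_eq hg
    exact ⟨QuadraticMap.linMulLin L M, fun x => by
      rw [map_mul, hL, hM, QuadraticMap.linMulLin_apply]⟩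
  | add f _ g _ hf hg =>
    obtain ⟨Q, hQ⟩ := hf
    obtain ⟨R, hR⟩ := hg
    exact ⟨Q + R, fun x => by rw [map_add, hQ, hR, add_apply]⟩

theorem infinite_realZeros_of_forall_mem {n k : ℕ} {f : MvPolynomial (Fin n) ℝ}
    (hf : f.IsHomogeneous k) {S : Set ℝ} (hS : S.Infinite) {v : ℝ → Fin n → ℝ}
    (hv : ∀ s ∈ S, v s ≠ 0) (hzero : ∀ s ∈ S, eval (v s) f = 0)
    (hinj : ∀ s ∈ S, ∀ s' ∈ S, ∀ a : ℝ, a • v s' = v s → s = s') : (realZeros f).Infinite := by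
  have : Infinite S := hS.to_subtype
  refine Set.infinite_of_injective_forall_mem
    (f := fun s : S => Projectivization.mk ℝ (v s) (hv s s.2)) (fun s s' h => ?_)
    (fun s => (mk_mem_realZeros_iff hf _).2 (hzero s s.2))
  obtain ⟨a, ha⟩ := (Projectivization.mk_eq_mk_iff' ℝ _ _ _ _).1 h
  exact Subtype.ext (hinj s s.2 s' s'.2 a ha)

theorem infinite_realZeros_of_line {n k : ℕ} {f : MvPolynomial (Fin n) ℝ} (hf : f.IsHomogeneous k)
    {x y : Fin n → ℝ} (hxy : LinearIndependent ℝ ![x, y])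
    (h : ∀ s : ℝ, eval (x + s • y) f = 0) : (realZeros f).Infinite := by
  rw [LinearIndependent.pair_iff] at hxy
  refine infinite_realZeros_of_forall_mem hf Set.infinite_univ (v := fun s => x + s • y)
    (fun s _ hs => ?_) (fun s _ => h s) fun s _ s' _ a ha => ?_
  · exact one_ne_zero (hxy 1 s (by rwa [one_smul])).1
  · obtain ⟨h1, h2⟩ := hxy (a - 1) (a * s' - s) (by rw [← sub_eq_zero.2 ha]; module)
    obtain rfl : a = 1 := sub_eq_zero.1 h1
    linarith

theorem infinite_realZeros_of_neg_of_pos {n k : ℕ} {f : MvPolynomial (Fin n) ℝ}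
    (hf : f.IsHomogeneous k) {x y z : Fin n → ℝ} (hli : LinearIndependent ℝ ![z, x, y])
    (hx : eval x f < 0) (hy : 0 < eval y f) : (realZeros f).Infinite := by
  have hli' : ∀ a b c : ℝ, c • z + a • x + b • y = 0 → a = 0 ∧ b = 0 ∧ c = 0 := by
    intro a b c h
    rw [Fintype.linearIndependent_iff] at hli
    have := hli ![c, a, b] (by simpa [Fin.sum_univ_three] using h)
    exact ⟨this 1, this 2, this 0⟩
  have hcont : Continuous fun v => eval v f := MvPolynomial.continuous_eval f
  -- `f` still changes sign on the segment from `x` to `y + s • z` for every small `s`.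
  have hS : {s : ℝ | 0 < eval (y + s • z) f}.Infinite := by
    refine infinite_of_mem_nhds 0 (IsOpen.mem_nhds ?_ ?_)
    · exact isOpen_lt continuous_const (hcont.comp (by fun_prop))
    · simpa using hy
  have hroot : ∀ s : ℝ, ∃ r : ℝ, 0 < eval (y + s • z) f →
      r ≠ 0 ∧ eval ((1 - r) • x + r • (y + s • z)) f = 0 := by
    intro s
    by_cases hs : 0 < eval (y + s • z) f
    · obtain ⟨r, -, hr⟩ := intermediate_value_Icc zero_le_one
        (f := fun r : ℝ => eval ((1 - r) • x + r • (y + s • z)) f)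
        (hcont.comp (by fun_prop)).continuousOn
        (show (0 : ℝ) ∈ Set.Icc _ _ from ⟨by simpa using hx.le, by simpa using hs.le⟩)
      refine ⟨r, fun _ => ⟨?_, hr⟩⟩
      rintro rfl
      simp [hx.ne] at hr
    · exact ⟨0, fun h => absurd h hs⟩
  choose r hr using hroot
  refine infinite_realZeros_of_forall_mem hf hS
    (v := fun s => (1 - r s) • x + r s • (y + s • z)) (fun s hs h0 => ?_)
    (fun s hs => (hr s hs).2) fun s hs s' _ a ha => ?_
  · exact (hr s hs).1 (hli' (1 - r s) (r s) (r s * s) (by rw [← h0]; module)).2.1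
  · obtain ⟨-, h1, h2⟩ := hli' (a * (1 - r s') - (1 - r s)) (a * r s' - r s)
      (a * (r s' * s') - r s * s) (by rw [← sub_eq_zero.2 ha]; module)
    refine mul_left_cancel₀ (hr s hs).1 ?_
    linear_combination s' * h1 - h2

theorem realZeros_congr {n : ℕ} {f g : MvPolynomial (Fin n) ℝ}
    (h : ∀ x, eval x f = 0 ↔ eval x g = 0) : realZeros f = realZeros g := by
  simp only [realZeros, h]

theorem realZeros_neg {n : ℕ} (f : MvPolynomial (Fin n) ℝ) : realZeros (-f) = realZeros f :=
  realZeros_congr fun x => by rw [map_neg, neg_eq_zero]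

theorem realZeros_mul {n k l : ℕ} {f g : MvPolynomial (Fin n) ℝ} (hf : f.IsHomogeneous k)
    (hg : g.IsHomogeneous l) : realZeros (f * g) = realZeros f ∪ realZeros g := by
  ext p
  induction p using Projectivization.ind with | h x hx =>
  rw [Set.mem_union, mk_mem_realZeros_iff (hf.mul hg), mk_mem_realZeros_iff hf,
    mk_mem_realZeros_iff hg, map_mul, mul_eq_zero]

theorem realZeros_eq_of_map_ofReal_eq {n : ℕ} {f g : MvPolynomial (Fin n) ℝ} {c : ℂ} (hc : c ≠ 0)
    (h : map (algebraMap ℝ ℂ) f = C c * map (algebraMap ℝ ℂ) g) : realZeros f = realZeros g :=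
  realZeros_congr fun x => by
    have hx := congrArg (eval (algebraMap ℝ ℂ ∘ x)) h
    rw [map_mul, eval_C, ← map_eval, ← map_eval] at hx
    rw [← map_eq_zero (algebraMap ℝ ℂ), hx, mul_eq_zero_iff_left hc, map_eq_zero]

theorem linearIndependent_rep_pair {n : ℕ} {p q : RealProj n} (hpq : p ≠ q) :
    LinearIndependent ℝ ![p.rep, q.rep] := by
  have hrep : Projectivization.rep ∘ ![p, q] = ![p.rep, q.rep] := by
    ext i
    fin_cases i <;> rfl
  rw [← hrep]
  exact Projectivization.independent_iff.1 ((Projectivization.independent_pair_iff_ne p q).2 hpq)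

theorem realZeros_subsingleton_of_nonneg {n : ℕ} {f : MvPolynomial (Fin n) ℝ}
    (hf : f.IsHomogeneous 2) (hfin : (realZeros f).Finite) (hnonneg : ∀ x, 0 ≤ eval x f) :
    (realZeros f).Subsingleton := by
  obtain ⟨Q, hQ⟩ := exists_quadraticMap_eval_eq hf
  intro p hp q hq
  by_contra hne
  refine hfin.not_infinite (infinite_realZeros_of_line hf (linearIndependent_rep_pair hne) ?_)
  have hline : ∀ s : ℝ, eval (p.rep + s • q.rep) f = s * QuadraticMap.polar Q p.rep q.rep := by
    intro s
    have hp0 : Q p.rep = 0 := hQ _ ▸ hp _ p.rep_nonzero p.mk_rep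
    have hq0 : Q q.rep = 0 := hQ _ ▸ hq _ q.rep_nonzero q.mk_rep
    rw [hQ, QuadraticMap.map_add Q, QuadraticMap.map_smul, QuadraticMap.polar_smul_right, hp0, hq0,
      smul_zero, zero_add, zero_add, smul_eq_mul]
  have hpolar : QuadraticMap.polar Q p.rep q.rep = 0 := by
    have hone := hline 1 ▸ hnonneg _
    have hneg := hline (-1) ▸ hnonneg _
    linarith
  exact fun s => by rw [hline, hpolar, mul_zero]

theorem realZeros_subsingleton_of_quadratic {n : ℕ} (hn : 3 ≤ n) {f : MvPolynomial (Fin n) ℝ}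
    (hf : f.IsHomogeneous 2) (hfin : (realZeros f).Finite) : (realZeros f).Subsingleton := by
  by_cases hnonneg : ∀ x, 0 ≤ eval x f
  · exact realZeros_subsingleton_of_nonneg hf hfin hnonneg
  by_cases hnonpos : ∀ x, eval x f ≤ 0
  · rw [← realZeros_neg] at hfin ⊢
    exact realZeros_subsingleton_of_nonneg hf.neg hfin fun x => by simpa using hnonpos x
  push Not at hnonneg hnonpos
  obtain ⟨x, hx⟩ := hnonneg
  obtain ⟨y, hy⟩ := hnonpos
  have hx0 : x ≠ 0 := by
    rintro rfl
    rw [← zero_smul ℝ (0 : Fin n → ℝ), eval_smul_of_isHomogeneous hf] at hx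
    simp at hx
  have hxy : LinearIndependent ℝ ![x, y] := by
    rw [LinearIndependent.pair_iff' hx0]
    rintro a rfl
    rw [eval_smul_of_isHomogeneous hf] at hy
    exact hy.not_ge (mul_nonpos_of_nonneg_of_nonpos (sq_nonneg a) hx.le)
  obtain ⟨z, hz⟩ := exists_linearIndependent_cons_of_lt_finrank hxy
    (by rw [Module.finrank_fin_fun]; omega)
  exact absurd hfin (infinite_realZeros_of_neg_of_pos hf hz hx hy).not_finite

theorem infinite_realZeros_of_linear_forms {n k : ℕ} (hn : 4 ≤ n) {f A B : MvPolynomial (Fin n) ℝ}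
    (hf : f.IsHomogeneous k) (hA : A.IsHomogeneous 1) (hB : B.IsHomogeneous 1)
    (h : ∀ x, eval x A = 0 → eval x B = 0 → eval x f = 0) : (realZeros f).Infinite := by
  obtain ⟨L, hL⟩ := exists_linearMap_eval_eq hA
  obtain ⟨M, hM⟩ := exists_linearMap_eval_eq hB
  have hker : 1 < Module.finrank ℝ (LinearMap.ker (L.prod M)) := by
    have hrank := (L.prod M).finrank_range_add_finrank_ker
    have hle := (LinearMap.range (L.prod M)).finrank_le
    rw [Module.finrank_prod, Module.finrank_self] at hle
    rw [Module.finrank_fin_fun] at hrank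
    omega
  obtain ⟨x, hx⟩ := Module.finrank_pos_iff_exists_ne_zero.1 (zero_lt_one.trans hker)
  obtain ⟨y, hxy⟩ := exists_linearIndependent_pair_of_one_lt_finrank hker hx
  have hli : LinearIndependent ℝ ![(x : Fin n → ℝ), y] := by
    rw [LinearIndependent.pair_iff] at hxy ⊢
    exact fun a b hab => hxy a b (Subtype.ext hab)
  refine infinite_realZeros_of_line hf hli fun s => ?_
  have hmem : L (x + s • y) = 0 ∧ M (x + s • y) = 0 := by
    simpa using (x + s • y).2
  exact h _ ((hL _).trans hmem.1) ((hM _).trans hmem.2)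

/-! ### Irreducibility of extremal forms -/

section Extremal

variable {n : ℕ} {f : MvPolynomial (Fin n) ℝ}

theorem map_ofReal_ne_zero (hf : f ≠ 0) : map (algebraMap ℝ ℂ) f ≠ 0 :=
  (map_ne_zero_iff _ (map_injective _ (algebraMap ℝ ℂ).injective)).2 hf

theorem C_mul_sq_mem_PSD {k : ℕ} {r : ℝ} (hr : 0 ≤ r) {q : MvPolynomial (Fin n) ℝ}
    (hq : q.IsHomogeneous k) : C r * q ^ 2 ∈ PSD n (k * 2) :=
  ⟨(hq.pow 2).C_mul r, fun x _ => by
    rw [map_mul, map_pow, eval_C]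
    positivity⟩

-- By extremality `q ^ 2` would be proportional to `f`, so that `q` has the zeros of `f`.
theorem eq_zero_of_sq_add_eq (hn : 3 ≤ n) (hf : f ∈ extremals (PSD n 4))
    (hcard : 2 ≤ (realZeros f).ncard) {q h : MvPolynomial (Fin n) ℝ} {r : ℝ} (hr : 0 < r)
    (hq : q.IsHomogeneous 2) (hh : h ∈ PSD n 4) (hqh : C r * q ^ 2 + h = f) : q = 0 := by
  obtain ⟨⟨α, -, hα⟩, -⟩ := hf.2.2 _ (C_mul_sq_mem_PSD hr.le hq) h hh hqh
  by_contra hq0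
  have hα0 : α ≠ 0 := by
    rintro rfl
    rw [zero_smul] at hα
    exact mul_ne_zero (C_ne_zero.2 hr.ne') (pow_ne_zero 2 hq0) hα
  have hzero : realZeros f = realZeros q := realZeros_congr fun x => by
    have hx := congrArg (eval x) hα
    rw [map_mul, map_pow, eval_C, smul_eval] at hx
    rw [← mul_eq_zero_iff_left hα0, ← hx, mul_eq_zero_iff_left hr.ne',
      pow_eq_zero_iff two_ne_zero]
  rw [hzero] at hcard
  have hfin : (realZeros q).Finite := Set.finite_of_ncard_pos (by omega)
  have hle := (Set.ncard_le_one hfin).2 (realZeros_subsingleton_of_quadratic hn hq hfin)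
  omega

theorem notMem_SOS_of_mem_extremals (hn : 3 ≤ n) (hf : f ∈ extremals (PSD n 4))
    (hcard : 2 ≤ (realZeros f).ncard) : f ∉ SOS n 2 := by
  rintro ⟨r, g, hg, rfl⟩
  refine hf.2.1 (Finset.sum_eq_zero fun i _ => ?_)
  have hrest : ∑ j ∈ Finset.univ.erase i, g j ^ 2 ∈ PSD n 4 :=
    ⟨IsHomogeneous.sum _ _ _ fun j _ => (show (g j).IsHomogeneous 2 from hg j).pow 2,
      fun x _ => by
        rw [map_sum]
        exact Finset.sum_nonneg fun j _ => by rw [map_pow]; positivity⟩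
  have hsum : C 1 * g i ^ 2 + ∑ j ∈ Finset.univ.erase i, g j ^ 2 = ∑ j, g j ^ 2 := by
    rw [C_1, one_mul, Finset.add_sum_erase _ (fun j => g j ^ 2) (Finset.mem_univ i)]
  rw [eq_zero_of_sq_add_eq hn hf hcard one_pos (hg i) hrest hsum, zero_pow two_ne_zero]

theorem infinite_realZeros_of_dvd (hn : 4 ≤ n) {k : ℕ} (hf : f.IsHomogeneous k)
    {p : MvPolynomial (Fin n) ℂ} (hp : p.IsHomogeneous 1) (hdvd : p ∣ map (algebraMap ℝ ℂ) f) :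
    (realZeros f).Infinite := by
  obtain ⟨A, B, hA, hB, rfl⟩ := exists_isHomogeneous_re_im hp
  obtain ⟨q, hq⟩ := hdvd
  refine infinite_realZeros_of_linear_forms hn hf hA hB fun x hxA hxB => ?_
  have hx := congrArg (eval (algebraMap ℝ ℂ ∘ x)) hq
  rw [map_mul, map_add, map_mul, ← map_eval, ← map_eval, ← map_eval, hxA, hxB] at hx
  simpa using hx

theorem ncard_realZeros_le_two (hn : 3 ≤ n) (hfin : (realZeros f).Finite)
    {p q : MvPolynomial (Fin n) ℂ} (hp : p.IsHomogeneous 2) (hq : q.IsHomogeneous 2)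
    (hpq : map (algebraMap ℝ ℂ) f = p * q) {c c' : ℂ} (hc : map (starRingEnd ℂ) p = C c * p)
    (hc' : map (starRingEnd ℂ) q = C c' * q) : (realZeros f).ncard ≤ 2 := by
  obtain ⟨D, hD, r, hr, rfl⟩ := exists_eq_C_mul_map_ofReal hp hc
  obtain ⟨E, hE, s, hs, rfl⟩ := exists_eq_C_mul_map_ofReal hq hc'
  have hunion : realZeros f = realZeros D ∪ realZeros E := by
    rw [← realZeros_mul hD hE]
    refine realZeros_eq_of_map_ofReal_eq (mul_ne_zero hr hs) ?_
    rw [hpq, map_mul (map _) D E, C_mul]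
    ring
  rw [hunion] at hfin ⊢
  have hfinD := hfin.subset Set.subset_union_left
  have hfinE := hfin.subset Set.subset_union_right
  calc (realZeros D ∪ realZeros E).ncard
      ≤ (realZeros D).ncard + (realZeros E).ncard := Set.ncard_union_le _ _
    _ ≤ 1 + 1 := add_le_add
        ((Set.ncard_le_one hfinD).2 (realZeros_subsingleton_of_quadratic hn hD hfinD))
        ((Set.ncard_le_one hfinE).2 (realZeros_subsingleton_of_quadratic hn hE hfinE))

theorem map_ofReal_ne_C_mul_mul_conj (hn : 3 ≤ n) (hf : f ∈ extremals (PSD n 4))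
    (hcard : 2 ≤ (realZeros f).ncard) {p : MvPolynomial (Fin n) ℂ} (hp : p.IsHomogeneous 2)
    (c : ℂ) : map (algebraMap ℝ ℂ) f ≠ C c * (p * map (starRingEnd ℂ) p) := by
  intro hfp
  obtain ⟨A, B, hA, hB, rfl⟩ := exists_isHomogeneous_re_im hp
  have heval : ∀ x, eval x f = c.re * (eval x A ^ 2 + eval x B ^ 2) := by
    have hmul : map (algebraMap ℝ ℂ) f = C c * map (algebraMap ℝ ℂ) (A ^ 2 + B ^ 2) := by
      have hI : (C Complex.I * C Complex.I : MvPolynomial (Fin n) ℂ) = -1 := by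
        rw [← C_mul, Complex.I_mul_I, C_neg, C_1]
      rw [hfp, map_conj_re_add_im, map_add, map_pow, map_pow]
      linear_combination -C c * map (algebraMap ℝ ℂ) B ^ 2 * hI
    intro x
    have hx := congrArg (eval (algebraMap ℝ ℂ ∘ x)) hmul
    rw [map_mul, eval_C, ← map_eval, ← map_eval] at hx
    have hre := congrArg Complex.re hx
    rw [Complex.coe_algebraMap, Complex.ofReal_re, Complex.re_mul_ofReal] at hre
    rw [hre, map_add, map_pow, map_pow]
  have hc : 0 < c.re := by
    by_contra! hc
    refine hf.2.1 (MvPolynomial.funext fun x => le_antisymm ?_ ?_)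
    · rw [heval, map_zero]
      exact mul_nonpos_of_nonpos_of_nonneg hc (by positivity)
    · simpa using hf.1.2 x trivial
  have hsum : C c.re * A ^ 2 + C c.re * B ^ 2 = f := MvPolynomial.funext fun x => by
    rw [heval]
    simp only [map_add, map_mul, map_pow, eval_C]
    ring
  have hA0 := eq_zero_of_sq_add_eq hn hf hcard hc hA (C_mul_sq_mem_PSD hc.le hB) hsum
  have hB0 := eq_zero_of_sq_add_eq hn hf hcard hc hB (C_mul_sq_mem_PSD hc.le hA)
    ((add_comm _ _).trans hsum)
  exact hf.2.1 (by simp [← hsum, hA0, hB0])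

theorem irreducible_of_quadratic {σ K : Type*} [Field K] {p : MvPolynomial σ K}
    (hp : p.IsHomogeneous 2) (hp0 : p ≠ 0)
    (hlin : ∀ l : MvPolynomial σ K, l.IsHomogeneous 1 → ¬ l ∣ p) : Irreducible p := by
  refine ⟨fun hunit => ?_, fun a b hab => ?_⟩
  · exact absurd (((isUnit_iff_isHomogeneous_zero hp0).1 hunit).inj_right hp hp0) two_ne_zero.symm
  · obtain ⟨i, j, hij, ha, hb⟩ := exists_isHomogeneous_of_mul (hab ▸ hp) (hab ▸ hp0)
    have hi : i ≠ 1 := by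
      rintro rfl
      exact hlin a ha ⟨b, hab⟩
    have hij' : i = 0 ∨ j = 0 := by omega
    rcases hij' with rfl | rfl
    · exact .inl ((isUnit_iff_isHomogeneous_zero (left_ne_zero_of_mul (hab ▸ hp0))).2 ha)
    · exact .inr ((isUnit_iff_isHomogeneous_zero (right_ne_zero_of_mul (hab ▸ hp0))).2 hb)

-- Conjugation preserves `f`, so it either fixes both irreducible factors up to constants, which
-- leaves at most two real zeros, or exchanges them, which makes `f` a sum of two squares.
theorem map_ofReal_ne_mul_of_quadratic (hn : 4 ≤ n) (hf : f ∈ extremals (PSD n 4))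
    (hfin : (realZeros f).Finite) (hcard : 3 ≤ (realZeros f).ncard) {p q : MvPolynomial (Fin n) ℂ}
    (hp : p.IsHomogeneous 2) (hq : q.IsHomogeneous 2) : map (algebraMap ℝ ℂ) f ≠ p * q := by
  intro hpq
  have hp0 : p ≠ 0 := by
    rintro rfl
    exact map_ofReal_ne_zero hf.2.1 (by rw [hpq, zero_mul])
  have hq0 : q ≠ 0 := by
    rintro rfl
    exact map_ofReal_ne_zero hf.2.1 (by rw [hpq, mul_zero])
  have hirr : Irreducible p := irreducible_of_quadratic hp hp0 fun l hl hdvd =>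
    infinite_realZeros_of_dvd hn hf.1.1 hl (hdvd.trans ⟨q, hpq⟩) hfin
  have hconj : p * q = map (starRingEnd ℂ) p * map (starRingEnd ℂ) q := by
    rw [← map_mul, ← hpq, map_conj_map_ofReal]
  have hinj := map_injective (σ := Fin n) _ (starRingEnd ℂ).injective
  rcases hirr.prime.dvd_or_dvd (hconj ▸ dvd_mul_right p q) with hdvd | hdvd
  · obtain ⟨c, -, hc⟩ :=
      exists_eq_C_mul_of_dvd (hp.map _) hp ((map_ne_zero_iff _ hinj).2 hp0) hdvd
    have hq_eq : q = C c * map (starRingEnd ℂ) q :=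
      mul_left_cancel₀ hp0 (by rw [hconj, hc]; ring)
    have hc' : map (starRingEnd ℂ) q = C (starRingEnd ℂ c) * q := by
      conv_lhs => rw [hq_eq, map_mul, map_C, map_conj_map_conj]
    exact absurd (ncard_realZeros_le_two (by omega) hfin hp hq hpq hc hc') (by omega)
  · obtain ⟨c, -, hc⟩ :=
      exists_eq_C_mul_of_dvd (hq.map _) hp ((map_ne_zero_iff _ hinj).2 hq0) hdvd
    have hq_eq : q = C (starRingEnd ℂ c) * map (starRingEnd ℂ) p := by
      rw [← map_conj_map_conj q, hc, map_mul, map_C]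
    refine map_ofReal_ne_C_mul_mul_conj (by omega) hf (by omega) hp (starRingEnd ℂ c) ?_
    rw [hpq, hq_eq, mul_left_comm]

theorem irreducible_of_mem_extremals (hn : 4 ≤ n) (hf : f ∈ extremals (PSD n 4))
    (hcard : 3 ≤ (realZeros f).ncard) : Irreducible (map (algebraMap ℝ ℂ) f) := by
  have hfin : (realZeros f).Finite := Set.finite_of_ncard_pos (by omega)
  have hhom : (map (algebraMap ℝ ℂ) f).IsHomogeneous 4 := IsHomogeneous.map hf.1.1 _
  have h0 := map_ofReal_ne_zero hf.2.1
  have hlin : ∀ l : MvPolynomial (Fin n) ℂ, l.IsHomogeneous 1 → ¬ l ∣ map (algebraMap ℝ ℂ) f :=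
    fun l hl hdvd => infinite_realZeros_of_dvd hn hf.1.1 hl hdvd hfin
  refine ⟨fun hunit => ?_, fun p q hpq => ?_⟩
  · exact absurd (((isUnit_iff_isHomogeneous_zero h0).1 hunit).inj_right hhom h0)
      (by norm_num)
  · obtain ⟨i, j, hij, hp, hq⟩ := exists_isHomogeneous_of_mul (hpq ▸ hhom) (hpq ▸ h0)
    have hi : i ≠ 1 := by
      rintro rfl
      exact hlin p hp ⟨q, hpq⟩
    have hj : j ≠ 1 := by
      rintro rfl
      exact hlin q hq ⟨p, hpq.trans (mul_comm p q)⟩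
    have hi2 : i ≠ 2 := by
      rintro rfl
      obtain rfl : j = 2 := by omega
      exact map_ofReal_ne_mul_of_quadratic hn hf hfin hcard hp hq hpq
    have hij' : i = 0 ∨ j = 0 := by omega
    rcases hij' with rfl | rfl
    · exact .inl ((isUnit_iff_isHomogeneous_zero (left_ne_zero_of_mul (hpq ▸ h0))).2 hp)
    · exact .inr ((isUnit_iff_isHomogeneous_zero (right_ne_zero_of_mul (hpq ▸ h0))).2 hq)

end Extremal

end SymQuartic

end

open SymQuartic in
theorem theorem1p9_general :
    IsOpen paramSet ∧ paramSet.Nonempty ∧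
    (∀ t u : ℝ, t ≠ 1 → u ≠ 0 → u ≠ -1 → 0 < VF t (omega u) →
      quartic t u ∈ SymPSD 4 4 ∧
      eval ![t, 1, 1, 1] (quartic t u) = 0 ∧
      eval ![u, u, 1, 1] (quartic t u) = 0 ∧
      quartic t u ∈ extremals (PSD 4 4) ∧
      quartic t u ∉ SOS 4 2 ∧
      Irreducible (map (algebraMap ℝ ℂ) (quartic t u)) ∧
      (realZeros (quartic t u)).ncard = 10 ∧
      IsDiscrete (realZeros (quartic t u))) ∧
    (∀ t u : ℝ, u ≠ 0 → (quartic t u ∈ SymPSD 4 4 ↔ 0 ≤ VF t (omega u))) ∧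
    (∀ t u : ℝ, u ≠ 0 → (t, u) ≠ (1, 1) → -quartic t u ∉ SymPSD 4 4) := by
  refine ⟨isOpen_paramSet, paramSet_nonempty, fun t u ht hu hu2 hV => ?_,
    fun t u hu => quartic_mem_SymPSD_iff hu, fun t u hu htu => neg_quartic_notMem_SymPSD hu htu⟩
  have hu1 : u ≠ 1 := by
    rintro rfl
    norm_num [VF, omega] at hV
  have hext := quartic_mem_extremals ht hu hu1 hu2 hV.le
  have hcard := ncard_realZeros_quartic ht hu hu1 hu2 hV
  exact ⟨(quartic_mem_SymPSD_iff hu).2 hV.le, eval_quartic_triple t u, eval_quartic_pair t hu, hext,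
    notMem_SOS_of_mem_extremals (by norm_num) hext (by omega),
    irreducible_of_mem_extremals (by norm_num) hext (by omega), hcard,
    isDiscrete_realZeros_quartic ht hu hV⟩

theorem theorem1p9 :
    -- the parameter set is a non-empty open subset of the plane
    IsOpen SymQuartic.paramSet ∧ SymQuartic.paramSet.Nonempty ∧
    -- the properties of the quartics with parameters in this set
    (∀ t u : ℝ, (t, u) ∈ SymQuartic.paramSet →
      SymQuartic.quartic t u ∈ SymQuartic.SymPSD 4 4 ∧
      MvPolynomial.eval ![t, 1, 1, 1] (SymQuartic.quartic t u) = 0 ∧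
      MvPolynomial.eval ![u, u, 1, 1] (SymQuartic.quartic t u) = 0 ∧
      SymQuartic.quartic t u ∈ SymQuartic.extremals (SymQuartic.PSD 4 4) ∧
      SymQuartic.quartic t u ∉ SymQuartic.SOS 4 2 ∧
      Irreducible (MvPolynomial.map (algebraMap ℝ ℂ) (SymQuartic.quartic t u)) ∧
      (SymQuartic.realZeros (SymQuartic.quartic t u)).ncard = 10 ∧
      IsDiscrete (SymQuartic.realZeros (SymQuartic.quartic t u))) ∧
    -- which of the quartics are positive semidefinite
    (∀ t u : ℝ, u ≠ 0 → u ≠ 1 →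
      (SymQuartic.quartic t u ∈ SymQuartic.SymPSD 4 4 ↔
        0 ≤ SymQuartic.VF t (SymQuartic.omega u))) ∧
    (∀ t u : ℝ, u ≠ 0 → (t, u) ≠ (1, 1) →
      -SymQuartic.quartic t u ∉ SymQuartic.SymPSD 4 4) ∧
    -- irreducibility and failure to be a sum of squares whenever the quartic is extremal
    (∀ t u : ℝ, t ≠ 1 → u ≠ 0 → u ≠ 1 → u ≠ -1 →
      0 < SymQuartic.VF t (SymQuartic.omega u) →
      SymQuartic.quartic t u ∈ SymQuartic.extremals (SymQuartic.PSD 4 4) →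
      Irreducible (MvPolynomial.map (algebraMap ℝ ℂ) (SymQuartic.quartic t u)) ∧
      SymQuartic.quartic t u ∉ SymQuartic.SOS 4 2) := by
  obtain ⟨hopen, hne, hA, hPSD, hneg⟩ := theorem1p9_general
  refine ⟨hopen, hne, fun t u ⟨_, ht, hu, _, hu2, _, _, _, hV⟩ => hA t u ht hu hu2 hV,
    fun t u hu _ => hPSD t u hu, hneg, fun t u ht hu _ hu2 hV _ => ?_⟩
  obtain ⟨-, -, -, -, hSOS, hirr, -, -⟩ := hA t u ht hu hu2 hV
  exact ⟨hirr, hSOS⟩
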